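/- **Setting.** Let $L$ be a finite dimensional complex solvable Lie algebra, $n=\dim L$, acting on the right by bounded operators on a complex Banach space $E$; that is, each $x\in L$ gives a bounded operator $e\mapsto ex$ of $E$, depending linearly on $x$, with $e[x,y]=(ex)y-(ey)x$ (for instance, $L$ is a Lie subalgebra of $\mathcal L(E)$, operators being written on the right). Let $L^{2\perp}=\{f\in L^*: f([x,y])=0 \text{ for all } x,y\in L\}$. For $f\in L^{2\perp}$ let $d_p(f):E\otimes\wedge^pL\to E\otimes\wedge^{p-1}L$ be the linear map $$d_p(f)\,e\langle x_1\wedge\dots\wedge x_p\rangle=\sum_{i=1}^{p}(-1)^{i+1}e(x_i-f(x_i))\langle x_1\wedge\dots\wedge\hat{x_i}\wedge\dots\wedge x_p\rangle+\sum_{1\le i<j\le p}(-1)^{i+j}e\langle[x_i,x_j]\wedge x_1\wedge\dots\wedge\hat{x_i}\wedge\dots\wedge\hat{x_j}\wedge\dots\wedge x_p\rangle,$$ with $d_p(f)=0$ for $p\le 0$ and $p\ge n+1$. Here $E\otimes\wedge^pL$ carries its Banach space topology (that of a finite direct sum of copies of $E$). Let $\Sigma_p(L,E)=\{f\in L^{2\perp}: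 R(d_{p+1}(f))\neq\operatorname{Ker}d_p(f)\}$, $R$ denoting the range, and for $0\le k\le n$ put $$\sigma_{\pi,k}(L,E)=\bigcup_{k\le p\le n}\Sigma_p(L,E)\ \cup\ \{f\in L^{2\perp}: R(d_k(f))\text{ is not closed}\}.$$ **Theorem 4.10.** For every $0\le k\le n$: 1. $\sigma_{\pi,k}(L,E)$ is a compact subset of $L^*$. 2. (Projection property.) Let $I$ be an ideal of $L$, acting on $E$ by restriction, $m=\dim I$, and let $\Pi:L^*\to I^*$ be the restriction map. Then $$\Pi\big(\sigma_{\pi,k}(L,E)\big)=\sigma_{\pi,k'}(I,E),\qquad k'=\max\{0,\;m-(n-k)\}.$$ -/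

import Mathlib

open scoped TensorProduct Topology

noncomputable section

namespace LieSpectra

variable {L : Type*} [LieRing L] [LieAlgebra ℂ L]
variable {E : Type*} [NormedAddCommGroup E] [NormedSpace ℂ E]

/-- The space of chains `E ⊗ ⋀ᵖ L`. -/
abbrev Chain (L : Type*) [LieRing L] [LieAlgebra ℂ L]
    (E : Type*) [NormedAddCommGroup E] [NormedSpace ℂ E] (p : ℕ) : Type _ :=
  E ⊗[ℂ] (⋀[ℂ]^p L)

/-- The Banach space topology of `E ⊗ ⋀ᵖ L ≅ E × ⋯ × E` (`dim ⋀ᵖ L` factors), described without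
choosing a basis of `⋀ᵖ L`: it is the coarsest topology for which all the maps
`id ⊗ φ : E ⊗ ⋀ᵖ L → E`, with `φ` a linear functional on `⋀ᵖ L`, are continuous. -/
abbrev chainTopology (L : Type*) [LieRing L] [LieAlgebra ℂ L]
    (E : Type*) [NormedAddCommGroup E] [NormedSpace ℂ E] (p : ℕ) :
    TopologicalSpace (Chain L E p) :=
  ⨅ φ : Module.Dual ℂ (⋀[ℂ]^p L),
    TopologicalSpace.induced (fun t => TensorProduct.rid ℂ E (LinearMap.lTensor E φ t))
      inferInstance

/-- The topology of the dual `L*` of the finite dimensional space `L`: pointwise convergence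
on `L`. -/
abbrev dualTopology (L : Type*) [LieRing L] [LieAlgebra ℂ L] :
    TopologicalSpace (Module.Dual ℂ L) :=
  TopologicalSpace.induced (fun (f : Module.Dual ℂ L) (x : L) => f x) inferInstance

/-- `L^{2⊥}`: the characters of `L`, i.e. the linear functionals vanishing on all brackets. -/
def characters (L : Type*) [LieRing L] [LieAlgebra ℂ L] : Set (Module.Dual ℂ L) :=
  {f | ∀ x y : L, f ⁅x, y⁆ = 0}

/-- A linear map `ρ : L → 𝓛(E)` is a right action of the Lie algebra `L` on `E` by bounded
operators: writing `e x = ρ x e`, one has `e[x,y] = (ex)y - (ey)x`. The standard example is a Lie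
subalgebra `L` of `𝓛(E)`, where operators are written on the right of their argument, so that a
product `xy` of operators is "first `x`, then `y`", and `[x,y] = xy - yx`; then `ρ` is the
inclusion. -/
def IsRightAction (ρ : L →ₗ[ℂ] E →L[ℂ] E) : Prop :=
  ∀ (x y : L) (e : E), ρ ⁅x, y⁆ e = ρ y (ρ x e) - ρ x (ρ y e)

/-- The linear map `e ↦ e (x - f(x))` of `E`. -/
def shifted (ρ : L →ₗ[ℂ] E →L[ℂ] E) (f : Module.Dual ℂ L) (x : L) : E →ₗ[ℂ] E :=
  (ρ x : E →ₗ[ℂ] E) - f x • LinearMap.id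

/-- `x ↦ (x₁, …, x_p) ↦ e ↦ e (x - f(x)) ⊗ x₁ ∧ ⋯ ∧ x_p`. -/
def actionTerm (ρ : L →ₗ[ℂ] E →L[ℂ] E) (f : Module.Dual ℂ L) (p : ℕ) :
    L →ₗ[ℂ] L [⋀^Fin p]→ₗ[ℂ] (E →ₗ[ℂ] Chain L E p) where
  toFun x := ((LinearMap.lcomp ℂ (Chain L E p) (shifted ρ f x)) ∘ₗ
    (TensorProduct.mk ℂ E (⋀[ℂ]^p L)).flip).compAlternatingMap (exteriorPower.ιMulti ℂ p)
  map_add' x y := by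
    ext v e
    simp [shifted, add_smul]
    abel
  map_smul' c x := by
    ext v e
    simp [shifted, mul_smul, smul_sub, TensorProduct.smul_tmul']

/-- The first sum in the differential: `e ⊗ x₁ ∧ ⋯ ∧ x_{p+1}` is sent to
`∑ₖ (-1)^{k+1} e (x_k - f(x_k)) ⊗ x₁ ∧ ⋯ x̂_k ⋯ ∧ x_{p+1}`. -/
def actionPart (ρ : L →ₗ[ℂ] E →L[ℂ] E) (f : Module.Dual ℂ L) (p : ℕ) :
    Chain L E (p + 1) →ₗ[ℂ] Chain L E p :=
  TensorProduct.lift (exteriorPower.alternatingMapLinearEquiv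
    (AlternatingMap.alternatizeUncurryFin (actionTerm ρ f p))).flip

/-- `(x, y) ↦ (x₁, …, x_q) ↦ [x, y] ∧ x₁ ∧ ⋯ ∧ x_q`. -/
def bracketTerm (L : Type*) [LieRing L] [LieAlgebra ℂ L] (q : ℕ) :
    L →ₗ[ℂ] L →ₗ[ℂ] L [⋀^Fin q]→ₗ[ℂ] (⋀[ℂ]^(q + 1) L) :=
  LinearMap.compr₂ (LieModule.toEnd ℂ L L : L →ₗ[ℂ] L →ₗ[ℂ] L)
    (exteriorPower.ιMulti ℂ (q + 1)).curryLeft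

/-- The map `x₁ ∧ ⋯ ∧ x_{q+2} ↦
∑_{k<l} (-1)^{k+l} [x_k, x_l] ∧ x₁ ∧ ⋯ x̂_k ⋯ x̂_l ⋯ ∧ x_{q+2}`. Antisymmetrizing the bracket term
twice counts every pair `k < l` twice, and counting indices from `0` costs a sign; see
`bracketMap_ιMulti` for the formula. -/
def bracketMap (L : Type*) [LieRing L] [LieAlgebra ℂ L] (q : ℕ) :
    (⋀[ℂ]^(q + 2) L) →ₗ[ℂ] (⋀[ℂ]^(q + 1) L) :=
  -((2 : ℂ)⁻¹ • exteriorPower.alternatingMapLinearEquiv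
    (AlternatingMap.alternatizeUncurryFin
      (AlternatingMap.alternatizeUncurryFinLM ∘ₗ bracketTerm L q)))

/-- The differential `d_p(f) : E ⊗ ⋀ᵖ L → E ⊗ ⋀ᵖ⁻¹ L`, with `d_0(f) = 0`. -/
def differential (ρ : L →ₗ[ℂ] E →L[ℂ] E) (f : Module.Dual ℂ L) :
    (p : ℕ) → Chain L E p →ₗ[ℂ] Chain L E (p - 1)
  | 0 => 0
  | 1 => actionPart ρ f 0
  | q + 2 => actionPart ρ f (q + 1) + LinearMap.lTensor E (bracketMap L q)

theorem actionPart_tmul (ρ : L →ₗ[ℂ] E →L[ℂ] E) (f : Module.Dual ℂ L) (p : ℕ)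
    (e : E) (v : Fin (p + 1) → L) :
    actionPart ρ f p (e ⊗ₜ exteriorPower.ιMulti ℂ (p + 1) v) =
      ∑ k : Fin (p + 1), (-1 : ℤ) ^ (k : ℕ) •
        ((ρ (v k) e - f (v k) • e) ⊗ₜ[ℂ] exteriorPower.ιMulti ℂ p (k.removeNth v)) := by
  simp [actionPart, AlternatingMap.alternatizeUncurryFin_apply, actionTerm, shifted,
    TensorProduct.sub_tmul, TensorProduct.smul_tmul']

/-- The pairs `i ≤ j` below encode the pairs `k = i.castSucc < l = j.succ` of indices counted
from `0`. -/
theorem bracketMap_ιMulti (q : ℕ) (v : Fin (q + 2) → L) :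
    bracketMap L q (exteriorPower.ιMulti ℂ (q + 2) v) =
      ∑ i : Fin (q + 1), ∑ j ≥ i, (-1 : ℤ) ^ (i + j + 1 : ℕ) •
        exteriorPower.ιMulti ℂ (q + 1)
          (Matrix.vecCons ⁅v i.castSucc, v j.succ⁆ (j.removeNth (i.castSucc.removeNth v))) := by
  simp only [bracketMap, LinearMap.neg_apply, LinearMap.smul_apply,
    exteriorPower.alternatingMapLinearEquiv_apply_ιMulti,
    AlternatingMap.alternatizeUncurryFin_alternatizeUncurryFinLM_comp_apply, bracketTerm]
  rw [Finset.smul_sum, ← Finset.sum_neg_distrib]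
  refine Finset.sum_congr rfl fun i _ => ?_
  rw [Finset.smul_sum, ← Finset.sum_neg_distrib]
  refine Finset.sum_congr rfl fun j _ => ?_
  rw [LinearMap.compr₂_apply, LinearMap.compr₂_apply]
  have hs : ⁅v j.succ, v i.castSucc⁆ = -⁅v i.castSucc, v j.succ⁆ := (lie_skew _ _).symm
  simp only [LieHom.coe_toLinearMap, LieModule.toEnd_apply_apply, hs, map_neg,
    AlternatingMap.neg_apply, AlternatingMap.curryLeft_apply_apply]
  rw [pow_succ, mul_neg_one, neg_smul]
  rcases neg_one_pow_eq_or ℤ (i + j : ℕ) with h | h <;> rw [h] <;> module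

/-- `Σ_p(L, E)`: the characters `f` with `H_p(E ⊗ ⋀ L, d(f)) ≠ 0`, i.e.
`R(d_{p+1}(f)) ≠ Ker d_p(f)`. -/
def homologySpectrum (ρ : L →ₗ[ℂ] E →L[ℂ] E) (p : ℕ) : Set (Module.Dual ℂ L) :=
  {f ∈ characters L |
    (LinearMap.range (differential ρ f (p + 1)) : Submodule ℂ (Chain L E p)) ≠
      LinearMap.ker (differential ρ f p)}

/-- `σ_{π,k}(L, E) = ⋃_{k ≤ p ≤ n} Σ_p(L, E) ∪ {f ∈ L^{2⊥} : R(d_k(f)) is not closed}`,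
where `n = dim L`. -/
def sigmaPi (ρ : L →ₗ[ℂ] E →L[ℂ] E) (k : ℕ) : Set (Module.Dual ℂ L) :=
  (⋃ p ∈ Set.Icc k (Module.finrank ℂ L), homologySpectrum ρ p) ∪
    {f ∈ characters L |
      ¬ IsClosed[chainTopology L E (k - 1)]
        (LinearMap.range (differential ρ f k) : Set (Chain L E (k - 1)))}

/-- The projection `L* → I*`, restriction of functionals to the ideal `I`. -/
def restrict (I : LieIdeal ℂ L) (f : Module.Dual ℂ L) : Module.Dual ℂ I :=
  f ∘ₗ (I.incl : I →ₗ[ℂ] L)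

end LieSpectra

end

open scoped TensorProduct Topology

noncomputable section

/-! Call a complex of Banach spaces strictly exact at a spot if it is exact there and the outgoing
map has closed range. By the open mapping theorem this is one estimate with a constant
(`StrictExact`). The set `sigmaPi ρ k` consists exactly of the characters whose complex fails to be
strictly exact in some degree `p ≥ k` (`sigmaPi_eq`), since in degrees above `k` exactness one step
lower already gives closed range. Everything else is proved for strict exactness.

Compactness. The boundary is affine in `f` (`bd_add`), and strict exactness survives small
perturbations of a complex (`StrictExact.perturb`), so the spectra are closed. Cartan's formula
(`bd_cwedge`) says that the Lie derivative along `y`, minus `f y`, is homotopic to zero; once `|f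
y|` exceeds the norm of the Lie derivative the complex contracts (`StrictExact.of_homotopy`), so the
spectra are bounded.

Projection. In a solvable algebra every proper ideal lies in the kernel of a nonzero character, so
induction on the codimension reduces to `L = A ⊕ ℂx` with `A` an ideal. Then the complex of `L` is
the mapping cone of `Θ - f x` on the complex of `A`, where `Θ` is the Lie derivative along `x`
(`CodimOne.bd_glue`). If `A` is strictly exact in degrees `p + 1` and `p`, so is the cone in degree
`p + 1` (`StrictExact.cone`); hence restrictions of spectral points are spectral. Conversely, let
`g` be spectral for `A`. The flow of `ad x` conjugates the complex of `g` to those of its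
translates, so the whole orbit of `g` is bounded; by Liouville it is constant
(`comp_eq_zero_of_mem_strictSpectrum`). Thus `g` kills `[x, A]`, and all its extensions to `L` are
characters, one for each value `μ` at `x`. If all of them were strictly exact in degrees `≥ k`,
descending induction from above `dim A` would make `A` strictly exact at `g` in degrees `≥ k - 1`:
by `StrictExact.descend`, an obstruction would be a space on which `Θ` has no approximate
eigenvalue, and such a space is zero. -/

namespace LieSpectra

/-! ### Exterior multiplication, contraction and derivations of the exterior algebra. -/

section Exterior

variable {V W : Type*} [AddCommGroup V] [Module ℂ V] [AddCommGroup W] [Module ℂ W]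

/-- Left exterior multiplication by a vector. -/
def wedge (p : ℕ) (x : V) : (⋀[ℂ]^p V) →ₗ[ℂ] (⋀[ℂ]^(p + 1) V) :=
  exteriorPower.alternatingMapLinearEquiv ((exteriorPower.ιMulti ℂ (p + 1)).curryLeft x)

theorem wedge_ιMulti (p : ℕ) (x : V) (v : Fin p → V) :
    wedge p x (exteriorPower.ιMulti ℂ p v) =
      exteriorPower.ιMulti ℂ (p + 1) (Matrix.vecCons x v) := by
  simp [wedge]

theorem ιMulti_succ (p : ℕ) (v : Fin (p + 1) → V) :
    exteriorPower.ιMulti ℂ (p + 1) v =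
      wedge p (v 0) (exteriorPower.ιMulti ℂ p (Fin.tail v)) := by
  rw [wedge_ιMulti]
  congr 1
  exact (Matrix.cons_head_tail v).symm

/-- Linear maps out of a positive exterior power are determined on products `x ∧ b`. -/
theorem exteriorPower_succ_ext {p : ℕ} {g h : (⋀[ℂ]^(p + 1) V) →ₗ[ℂ] W}
    (H : ∀ x, g ∘ₗ wedge p x = h ∘ₗ wedge p x) : g = h := by
  apply exteriorPower.linearMap_ext
  ext v
  simp only [LinearMap.compAlternatingMap_apply, ιMulti_succ]
  exact LinearMap.congr_fun (H (v 0)) _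

theorem wedge_add (p : ℕ) (x y : V) : wedge p (x + y) = wedge p x + wedge p y := by
  simp [wedge]

theorem wedge_smul (p : ℕ) (c : ℂ) (x : V) : wedge p (c • x) = c • wedge p x := by
  simp [wedge]

/-- Left exterior multiplication, linear in the vector. -/
def wedgeLM (p : ℕ) : V →ₗ[ℂ] (⋀[ℂ]^p V) →ₗ[ℂ] (⋀[ℂ]^(p + 1) V) where
  toFun := wedge p
  map_add' := wedge_add p
  map_smul' := wedge_smul p

@[simp] theorem wedgeLM_apply (p : ℕ) (x : V) : wedgeLM p x = wedge p x := rfl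

theorem wedge_sub (p : ℕ) (x y : V) : wedge p (x - y) = wedge p x - wedge p y :=
  map_sub (wedgeLM p) x y

theorem wedge_self (p : ℕ) (x : V) (b : ⋀[ℂ]^p V) : wedge (p + 1) x (wedge p x b) = 0 := by
  suffices h : wedge (p + 1) x ∘ₗ wedge p x = 0 from LinearMap.congr_fun h b
  apply exteriorPower.linearMap_ext
  ext v
  simp only [LinearMap.compAlternatingMap_apply, LinearMap.comp_apply, wedge_ιMulti,
    LinearMap.zero_apply]
  congr 1
  exact (exteriorPower.ιMulti ℂ (p + 2)).map_eq_zero_of_eq _ (i := 0) (j := 1) rfl (by simp)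

theorem wedge_swap (p : ℕ) (x y : V) (b : ⋀[ℂ]^p V) :
    wedge (p + 1) x (wedge p y b) = -wedge (p + 1) y (wedge p x b) := by
  have h := wedge_self p (x + y) b
  simp only [wedge_add, LinearMap.add_apply, map_add, wedge_self, zero_add, add_zero] at h
  exact eq_neg_of_add_eq_zero_right h

/-- Contraction with a linear functional. -/
def contr (p : ℕ) (φ : Module.Dual ℂ V) : (⋀[ℂ]^(p + 1) V) →ₗ[ℂ] (⋀[ℂ]^p V) :=
  exteriorPower.alternatingMapLinearEquiv
    (AlternatingMap.alternatizeUncurryFin (φ.smulRight (exteriorPower.ιMulti ℂ p)))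

theorem contr_ιMulti (p : ℕ) (φ : Module.Dual ℂ V) (v : Fin (p + 1) → V) :
    contr p φ (exteriorPower.ιMulti ℂ (p + 1) v) =
      ∑ k : Fin (p + 1), (-1 : ℤ) ^ (k : ℕ) •
        φ (v k) • exteriorPower.ιMulti ℂ p (k.removeNth v) := by
  simp [contr, AlternatingMap.alternatizeUncurryFin_apply]

theorem removeNth_succ_vecCons {α : Type*} {p : ℕ} (k : Fin (p + 1)) (x : α) (v : Fin (p + 1) → α) :
    k.succ.removeNth (α := fun _ => α) (Matrix.vecCons x v) =
      Matrix.vecCons x (k.removeNth (α := fun _ => α) v) := by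
  funext i
  refine Fin.cases ?_ (fun i => ?_) i <;> simp [Fin.removeNth]

theorem contr_wedge_zero (φ : Module.Dual ℂ V) (x : V) (b : ⋀[ℂ]^0 V) :
    contr 0 φ (wedge 0 x b) = φ x • b := by
  suffices h : contr 0 φ ∘ₗ wedge 0 x = φ x • LinearMap.id from LinearMap.congr_fun h b
  apply exteriorPower.linearMap_ext
  ext v
  simp only [LinearMap.compAlternatingMap_apply, LinearMap.comp_apply, wedge_ιMulti, contr_ιMulti,
    Fin.sum_univ_succ]
  simp

/-- Contraction is an antiderivation: in the expansion of the contraction the term of index `0`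
gives `φ x • b`, and every other sign shifts by one. -/
theorem contr_wedge (p : ℕ) (φ : Module.Dual ℂ V) (x : V) (b : ⋀[ℂ]^(p + 1) V) :
    contr (p + 1) φ (wedge (p + 1) x b) = φ x • b - wedge p x (contr p φ b) := by
  suffices h : contr (p + 1) φ ∘ₗ wedge (p + 1) x =
      φ x • LinearMap.id - wedge p x ∘ₗ contr p φ from LinearMap.congr_fun h b
  apply exteriorPower.linearMap_ext
  ext v : 1
  simp only [LinearMap.compAlternatingMap_apply, LinearMap.comp_apply, wedge_ιMulti, contr_ιMulti,
    LinearMap.sub_apply, LinearMap.smul_apply, LinearMap.id_apply, map_sum, map_zsmul, map_smul]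
  rw [Fin.sum_univ_succ]
  simp [removeNth_succ_vecCons, pow_succ, sub_eq_add_neg]

theorem contr_add (p : ℕ) (φ ψ : Module.Dual ℂ V) : contr p (φ + ψ) = contr p φ + contr p ψ := by
  apply exteriorPower.linearMap_ext
  ext v : 1
  simp [contr_ιMulti, add_smul, Finset.sum_add_distrib]

theorem contr_smul (p : ℕ) (c : ℂ) (φ : Module.Dual ℂ V) : contr p (c • φ) = c • contr p φ := by
  apply exteriorPower.linearMap_ext
  ext v : 1
  simp only [LinearMap.compAlternatingMap_apply, contr_ιMulti, LinearMap.smul_apply,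
    Finset.smul_sum, smul_eq_mul]
  refine Finset.sum_congr rfl fun k _ => ?_
  rw [smul_comm c, mul_smul]

theorem map_wedge (p : ℕ) (g : V →ₗ[ℂ] W) (x : V) (b : ⋀[ℂ]^p V) :
    exteriorPower.map (p + 1) g (wedge p x b) = wedge p (g x) (exteriorPower.map p g b) := by
  suffices h : exteriorPower.map (p + 1) g ∘ₗ wedge p x =
      wedge p (g x) ∘ₗ exteriorPower.map p g from LinearMap.congr_fun h b
  apply exteriorPower.linearMap_ext
  ext v : 1
  simp only [LinearMap.compAlternatingMap_apply, LinearMap.comp_apply, wedge_ιMulti,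
    exteriorPower.map_apply_ιMulti]
  congr 1
  funext i
  refine Fin.cases ?_ (fun i => ?_) i <;> simp

variable [FiniteDimensional ℂ V]

/-- The extension of an endomorphism `δ` of `V` to a derivation of the exterior algebra. -/
def extDer (δ : V →ₗ[ℂ] V) : (p : ℕ) → (⋀[ℂ]^p V) →ₗ[ℂ] (⋀[ℂ]^p V)
  | 0 => 0
  | p + 1 => ∑ i, wedge p (δ (Module.finBasis ℂ V i)) ∘ₗ
      contr p ((Module.finBasis ℂ V).coord i)

theorem sum_coord_smul_wedge (δ : V →ₗ[ℂ] V) (p : ℕ) (x : V) (b : ⋀[ℂ]^p V) :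
    ∑ i, (Module.finBasis ℂ V).coord i x • wedge p (δ (Module.finBasis ℂ V i)) b =
      wedge p (δ x) b := by
  conv_rhs => rw [← (Module.finBasis ℂ V).sum_repr x, ← wedgeLM_apply]
  simp only [map_sum, map_smul, LinearMap.sum_apply, LinearMap.smul_apply, wedgeLM_apply,
    Module.Basis.coord_apply]

theorem extDer_wedge (δ : V →ₗ[ℂ] V) (p : ℕ) (x : V) (b : ⋀[ℂ]^p V) :
    extDer δ (p + 1) (wedge p x b) = wedge p (δ x) b + wedge p x (extDer δ p b) := by
  rw [← sum_coord_smul_wedge δ]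
  cases p with
  | zero =>
    simp [extDer, contr_wedge_zero]
  | succ p =>
    simp only [extDer, LinearMap.sum_apply, LinearMap.comp_apply, contr_wedge, map_sub, map_smul,
      map_sum, Finset.sum_sub_distrib]
    rw [sub_eq_add_neg, ← Finset.sum_neg_distrib]
    congr 1
    refine Finset.sum_congr rfl fun i _ => ?_
    rw [wedge_swap, neg_neg]

theorem extDer_ιMulti (δ : V →ₗ[ℂ] V) (p : ℕ) (v : Fin (p + 1) → V) :
    extDer δ (p + 1) (exteriorPower.ιMulti ℂ (p + 1) v) =
      ∑ k : Fin (p + 1), (-1 : ℤ) ^ (k : ℕ) •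
        exteriorPower.ιMulti ℂ (p + 1) (Matrix.vecCons (δ (v k)) (k.removeNth v)) := by
  simp only [extDer, LinearMap.sum_apply, LinearMap.comp_apply, contr_ιMulti, map_sum, map_zsmul,
    map_smul]
  rw [Finset.sum_comm]
  refine Finset.sum_congr rfl fun k _ => ?_
  rw [← Finset.smul_sum, sum_coord_smul_wedge, wedge_ιMulti]

theorem extDer_bracket (δ δ' δ'' : V →ₗ[ℂ] V) (h : ∀ x, δ'' x = δ (δ' x) - δ' (δ x)) (p : ℕ)
    (b : ⋀[ℂ]^p V) :
    extDer δ'' p b = extDer δ p (extDer δ' p b) - extDer δ' p (extDer δ p b) := by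
  induction p with
  | zero => simp [extDer]
  | succ p ih =>
    suffices H : extDer δ'' (p + 1) = extDer δ (p + 1) ∘ₗ extDer δ' (p + 1) -
        extDer δ' (p + 1) ∘ₗ extDer δ (p + 1) from LinearMap.congr_fun H b
    refine exteriorPower_succ_ext fun x => LinearMap.ext fun b => ?_
    simp only [LinearMap.comp_apply, LinearMap.sub_apply, extDer_wedge, map_add, ih, h, wedge_sub,
      map_sub]
    abel

theorem map_extDer [FiniteDimensional ℂ W] (g : V →ₗ[ℂ] W) (δ : V →ₗ[ℂ] V) (δ' : W →ₗ[ℂ] W)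
    (h : ∀ x, g (δ x) = δ' (g x)) (p : ℕ) (b : ⋀[ℂ]^p V) :
    exteriorPower.map p g (extDer δ p b) = extDer δ' p (exteriorPower.map p g b) := by
  induction p with
  | zero => simp [extDer]
  | succ p ih =>
    suffices H : exteriorPower.map (p + 1) g ∘ₗ extDer δ (p + 1) =
        extDer δ' (p + 1) ∘ₗ exteriorPower.map (p + 1) g from LinearMap.congr_fun H b
    refine exteriorPower_succ_ext fun x => LinearMap.ext fun b => ?_
    simp only [LinearMap.comp_apply, extDer_wedge, map_add, ih, h, map_wedge]

end Exterior

/-! ### Recursion for the bracket part of the differential. -/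

section Bracket

variable {L : Type*} [LieRing L] [LieAlgebra ℂ L] [FiniteDimensional ℂ L]

/-- The adjoint action as a linear endomorphism. -/
abbrev adL (x : L) : L →ₗ[ℂ] L := LieModule.toEnd ℂ L L x

theorem bracketMap_wedge_zero (x : L) (b : ⋀[ℂ]^1 L) :
    bracketMap L 0 (wedge 1 x b) = -extDer (adL x) 1 b := by
  suffices h : bracketMap L 0 ∘ₗ wedge 1 x = -extDer (adL x) 1 from LinearMap.congr_fun h b
  apply exteriorPower.linearMap_ext
  ext v : 1
  simp only [LinearMap.compAlternatingMap_apply, LinearMap.comp_apply, LinearMap.neg_apply,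
    wedge_ιMulti, bracketMap_ιMulti, extDer_ιMulti]
  simp

/-- Splits the sum over pairs of indices: the pairs containing the first index assemble to `ad x`
extended as a derivation, the remaining ones to the bracket map of `b`. This turns the explicit
formula into a recursion, on which all later inductions run. -/
theorem bracketMap_wedge (q : ℕ) (x : L) (b : ⋀[ℂ]^(q + 2) L) :
    bracketMap L (q + 1) (wedge (q + 2) x b) =
      -extDer (adL x) (q + 2) b - wedge (q + 1) x (bracketMap L q b) := by
  suffices h : bracketMap L (q + 1) ∘ₗ wedge (q + 2) x =
    -extDer (adL x) (q + 2) - wedge (q + 1) x ∘ₗ bracketMap L q from LinearMap.congr_fun h b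
  apply exteriorPower.linearMap_ext
  ext v : 1
  simp only [LinearMap.compAlternatingMap_apply, LinearMap.comp_apply, LinearMap.neg_apply,
    LinearMap.sub_apply, wedge_ιMulti, bracketMap_ιMulti, extDer_ιMulti, map_sum, map_zsmul]
  rw [Fin.sum_univ_succ, sub_eq_add_neg, ← Finset.sum_neg_distrib, ← Finset.sum_neg_distrib]
  congr 1
  · rw [show Finset.Ici (0 : Fin (q + 2)) = Finset.univ by ext; simp]
    refine Finset.sum_congr rfl fun j _ => ?_
    simp [pow_succ]
  · refine Finset.sum_congr rfl fun i _ => ?_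
    rw [← Finset.sum_neg_distrib]
    have : Finset.Ici i.succ = (Finset.Ici i).map (Fin.succEmb _) := by
      ext j
      refine Fin.cases ?_ (fun j => ?_) j <;> simp
    rw [this, Finset.sum_map]
    refine Finset.sum_congr rfl fun j _ => ?_
    simp only [Fin.coe_succEmb, Fin.castSucc_succ, removeNth_succ_vecCons, Matrix.cons_val_succ]
    rw [← wedge_ιMulti, ← wedge_ιMulti, wedge_swap, ← wedge_ιMulti, smul_neg, Fin.val_succ,
      Fin.val_succ, show (i : ℕ) + 1 + (j + 1) + 1 = i + j + 1 + 2 by ring, pow_add]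
    simp [wedge_ιMulti]

end Bracket

/-! ### Cartan calculus on the chain complex. -/

section ChainAlgebra

variable {L : Type*} [LieRing L] [LieAlgebra ℂ L]
variable {E : Type*} [NormedAddCommGroup E] [NormedSpace ℂ E]
variable {W : Type*} [AddCommGroup W] [Module ℂ W]

/-- `e ⊗ b ↦ e ⊗ (x ∧ b)`. -/
def cwedge (E : Type*) [NormedAddCommGroup E] [NormedSpace ℂ E] (p : ℕ) (x : L) :
    Chain L E p →ₗ[ℂ] Chain L E (p + 1) :=
  LinearMap.lTensor E (wedge p x)

/-- `e ⊗ b ↦ e ⊗ ι_φ b`. -/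
def ccontr (E : Type*) [NormedAddCommGroup E] [NormedSpace ℂ E] (p : ℕ) (φ : Module.Dual ℂ L) :
    Chain L E (p + 1) →ₗ[ℂ] Chain L E p :=
  LinearMap.lTensor E (contr p φ)

/-- The boundary in positive degree, with its codomain in normal form. -/
abbrev bd (ρ : L →ₗ[ℂ] E →L[ℂ] E) (f : Module.Dual ℂ L) (p : ℕ) :
    Chain L E (p + 1) →ₗ[ℂ] Chain L E p :=
  differential ρ f (p + 1)

@[simp] theorem cwedge_tmul (p : ℕ) (x : L) (e : E) (b : ⋀[ℂ]^p L) :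
    cwedge E p x (e ⊗ₜ b) = e ⊗ₜ wedge p x b := rfl

@[simp] theorem ccontr_tmul (p : ℕ) (φ : Module.Dual ℂ L) (e : E) (b : ⋀[ℂ]^(p + 1) L) :
    ccontr E p φ (e ⊗ₜ b) = e ⊗ₜ contr p φ b := rfl

theorem chain_succ_ext {p : ℕ} {g h : Chain L E (p + 1) →ₗ[ℂ] W}
    (H : ∀ x b, g (cwedge E p x b) = h (cwedge E p x b)) : g = h := by
  refine TensorProduct.ext (LinearMap.ext fun e => ?_)
  refine exteriorPower_succ_ext fun x => LinearMap.ext fun b => ?_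
  exact H x (e ⊗ₜ b)

/-- Two linear maps on chains agree if they agree on decomposable chains. -/
theorem chain_ext {p : ℕ} {g h : Chain L E p →ₗ[ℂ] W}
    (H : ∀ e v, g (e ⊗ₜ exteriorPower.ιMulti ℂ p v) = h (e ⊗ₜ exteriorPower.ιMulti ℂ p v)) :
    g = h := by
  refine TensorProduct.ext (LinearMap.ext fun e => ?_)
  refine exteriorPower.linearMap_ext (AlternatingMap.ext fun v => ?_)
  exact H e v

theorem cwedge_sub (p : ℕ) (x y : L) (b : Chain L E p) :
    cwedge E p (x - y) b = cwedge E p x b - cwedge E p y b := by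
  simp [cwedge, wedge_sub, LinearMap.lTensor_sub]

theorem cwedge_swap (p : ℕ) (x y : L) (b : Chain L E p) :
    cwedge E (p + 1) x (cwedge E p y b) = -cwedge E (p + 1) y (cwedge E p x b) := by
  suffices h : cwedge E (p + 1) x ∘ₗ cwedge E p y = -(cwedge E (p + 1) y ∘ₗ cwedge E p x) from
    LinearMap.congr_fun h b
  refine TensorProduct.ext' fun e b => ?_
  simp only [LinearMap.comp_apply, LinearMap.neg_apply, cwedge_tmul]
  rw [wedge_swap, TensorProduct.tmul_neg]

theorem cwedge_self (p : ℕ) (x : L) (b : Chain L E p) :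
    cwedge E (p + 1) x (cwedge E p x b) = 0 := by
  suffices h : cwedge E (p + 1) x ∘ₗ cwedge E p x = 0 from LinearMap.congr_fun h b
  refine TensorProduct.ext' fun e b => ?_
  simp [wedge_self]

theorem ccontr_cwedge_zero (φ : Module.Dual ℂ L) (x : L) (b : Chain L E 0) :
    ccontr E 0 φ (cwedge E 0 x b) = φ x • b := by
  suffices h : ccontr E 0 φ ∘ₗ cwedge E 0 x = φ x • LinearMap.id from LinearMap.congr_fun h b
  refine TensorProduct.ext' fun e b => ?_
  simp [contr_wedge_zero]

theorem ccontr_cwedge (p : ℕ) (φ : Module.Dual ℂ L) (x : L) (b : Chain L E (p + 1)) :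
    ccontr E (p + 1) φ (cwedge E (p + 1) x b) = φ x • b - cwedge E p x (ccontr E p φ b) := by
  suffices h : ccontr E (p + 1) φ ∘ₗ cwedge E (p + 1) x =
      φ x • LinearMap.id - cwedge E p x ∘ₗ ccontr E p φ from LinearMap.congr_fun h b
  refine TensorProduct.ext' fun e b => ?_
  simp [contr_wedge, TensorProduct.tmul_sub]

theorem ccontr_add (p : ℕ) (φ ψ : Module.Dual ℂ L) :
    ccontr E p (φ + ψ) = ccontr E p φ + ccontr E p ψ := by
  simp [ccontr, contr_add, LinearMap.lTensor_add]

theorem ccontr_smul (p : ℕ) (c : ℂ) (φ : Module.Dual ℂ L) :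
    ccontr E p (c • φ) = c • ccontr E p φ := by
  simp [ccontr, contr_smul, LinearMap.lTensor_smul]

section Lie

theorem actionPart_cwedge_zero (ρ : L →ₗ[ℂ] E →L[ℂ] E) (f : Module.Dual ℂ L) (x : L)
    (b : Chain L E 0) :
    actionPart ρ f 0 (cwedge E 0 x b) =
      LinearMap.rTensor (⋀[ℂ]^0 L) (ρ x : E →ₗ[ℂ] E) b - f x • b := by
  suffices h : actionPart ρ f 0 ∘ₗ cwedge E 0 x =
      LinearMap.rTensor (⋀[ℂ]^0 L) (ρ x : E →ₗ[ℂ] E) - f x • LinearMap.id from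
    LinearMap.congr_fun h b
  refine chain_ext fun e v => ?_
  simp [wedge_ιMulti, actionPart_tmul, TensorProduct.sub_tmul, TensorProduct.smul_tmul']

theorem actionPart_cwedge (ρ : L →ₗ[ℂ] E →L[ℂ] E) (f : Module.Dual ℂ L) (p : ℕ) (x : L)
    (b : Chain L E (p + 1)) :
    actionPart ρ f (p + 1) (cwedge E (p + 1) x b) =
      LinearMap.rTensor (⋀[ℂ]^(p + 1) L) (ρ x : E →ₗ[ℂ] E) b - f x • b -
        cwedge E p x (actionPart ρ f p b) := by
  suffices h : actionPart ρ f (p + 1) ∘ₗ cwedge E (p + 1) x =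
      LinearMap.rTensor (⋀[ℂ]^(p + 1) L) (ρ x : E →ₗ[ℂ] E) - f x • LinearMap.id -
        cwedge E p x ∘ₗ actionPart ρ f p from
    LinearMap.congr_fun h b
  refine chain_ext fun e v => ?_
  simp only [LinearMap.comp_apply, LinearMap.sub_apply, cwedge_tmul, wedge_ιMulti, actionPart_tmul,
    map_sum, map_zsmul]
  rw [Fin.sum_univ_succ, sub_eq_add_neg (_ - _), ← Finset.sum_neg_distrib]
  congr 1
  · simp [TensorProduct.sub_tmul, TensorProduct.smul_tmul']
  · refine Finset.sum_congr rfl fun i _ => ?_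
    simp [removeNth_succ_vecCons, pow_succ, wedge_ιMulti]

variable [FiniteDimensional ℂ L]

/-- The operator `R ⊗ 1 - 1 ⊗ δ` on chains, with `δ` extended as a derivation of `⋀ L`. -/
def lieOp (R : E →L[ℂ] E) (δ : L →ₗ[ℂ] L) (p : ℕ) : Chain L E p →ₗ[ℂ] Chain L E p :=
  LinearMap.rTensor (⋀[ℂ]^p L) (R : E →ₗ[ℂ] E) - LinearMap.lTensor E (extDer δ p)

theorem lieOp_tmul (R : E →L[ℂ] E) (δ : L →ₗ[ℂ] L) (p : ℕ) (e : E) (b : ⋀[ℂ]^p L) :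
    lieOp R δ p (e ⊗ₜ b) = R e ⊗ₜ b - e ⊗ₜ extDer δ p b := by
  simp [lieOp]

theorem lieOp_cwedge (R : E →L[ℂ] E) (δ : L →ₗ[ℂ] L) (p : ℕ) (x : L) (b : Chain L E p) :
    lieOp R δ (p + 1) (cwedge E p x b) = cwedge E p x (lieOp R δ p b) - cwedge E p (δ x) b := by
  suffices h : lieOp R δ (p + 1) ∘ₗ cwedge E p x =
      cwedge E p x ∘ₗ lieOp R δ p - cwedge E p (δ x) from LinearMap.congr_fun h b
  refine TensorProduct.ext' fun e b => ?_
  simp only [LinearMap.comp_apply, LinearMap.sub_apply, cwedge_tmul, lieOp_tmul, map_sub,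
    extDer_wedge, TensorProduct.tmul_add]
  abel

/-- The minus sign in front of `lieOp Q κ` reflects the right action: `Q` is the commutator of `R`
and `S` in the reversed order, while `κ` is the ordinary commutator of `δ` and `η`. -/
theorem lieOp_comm (R S Q : E →L[ℂ] E) (δ η κ : L →ₗ[ℂ] L) (hQ : ∀ e, Q e = S (R e) - R (S e))
    (hκ : ∀ x, κ x = δ (η x) - η (δ x)) (p : ℕ) (b : Chain L E p) :
    lieOp R δ p (lieOp S η p b) = lieOp S η p (lieOp R δ p b) - lieOp Q κ p b := by
  suffices h : lieOp R δ p ∘ₗ lieOp S η p = lieOp S η p ∘ₗ lieOp R δ p - lieOp Q κ p from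
    LinearMap.congr_fun h b
  refine TensorProduct.ext' fun e b => ?_
  simp only [LinearMap.comp_apply, LinearMap.sub_apply, lieOp_tmul, map_sub,
    extDer_bracket δ η κ hκ, TensorProduct.tmul_sub, TensorProduct.sub_tmul, hQ]
  abel

theorem bd_cwedge_zero (ρ : L →ₗ[ℂ] E →L[ℂ] E) (f : Module.Dual ℂ L) (x : L) (b : Chain L E 0) :
    bd ρ f 0 (cwedge E 0 x b) = lieOp (ρ x) (adL x) 0 b - f x • b := by
  change actionPart ρ f 0 (cwedge E 0 x b) = _
  rw [actionPart_cwedge_zero]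
  simp [lieOp, extDer]

/-- Cartan's formula. -/
theorem bd_cwedge (ρ : L →ₗ[ℂ] E →L[ℂ] E) (f : Module.Dual ℂ L) (p : ℕ) (x : L)
    (b : Chain L E (p + 1)) :
    bd ρ f (p + 1) (cwedge E (p + 1) x b) =
      lieOp (ρ x) (adL x) (p + 1) b - f x • b - cwedge E p x (bd ρ f p b) := by
  cases p with
  | zero =>
    change actionPart ρ f 1 (cwedge E 1 x b) +
      LinearMap.lTensor E (bracketMap L 0) (cwedge E 1 x b) = lieOp (ρ x) (adL x) 1 b - f x • b -
        cwedge E 0 x (actionPart ρ f 0 b)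
    rw [actionPart_cwedge]
    have h : LinearMap.lTensor E (bracketMap L 0) ∘ₗ cwedge E 1 x =
        -LinearMap.lTensor E (extDer (adL x) 1) := by
      refine TensorProduct.ext' fun e b => ?_
      simp [bracketMap_wedge_zero, TensorProduct.tmul_neg]
    have h' := LinearMap.congr_fun h b
    simp only [LinearMap.comp_apply, LinearMap.neg_apply] at h'
    rw [h', lieOp, LinearMap.sub_apply]
    abel
  | succ p =>
    change actionPart ρ f (p + 2) (cwedge E (p + 2) x b) +
      LinearMap.lTensor E (bracketMap L (p + 1)) (cwedge E (p + 2) x b) =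
        lieOp (ρ x) (adL x) (p + 2) b - f x • b -
        cwedge E (p + 1) x (actionPart ρ f (p + 1) b + LinearMap.lTensor E (bracketMap L p) b)
    rw [actionPart_cwedge]
    have h : LinearMap.lTensor E (bracketMap L (p + 1)) ∘ₗ cwedge E (p + 2) x =
        -LinearMap.lTensor E (extDer (adL x) (p + 2)) -
          cwedge E (p + 1) x ∘ₗ LinearMap.lTensor E (bracketMap L p) := by
      refine TensorProduct.ext' fun e b => ?_
      simp [bracketMap_wedge, TensorProduct.tmul_neg, TensorProduct.tmul_sub]
    have h' := LinearMap.congr_fun h b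
    simp only [LinearMap.comp_apply, LinearMap.neg_apply, LinearMap.sub_apply] at h'
    rw [h', lieOp, LinearMap.sub_apply, map_add]
    abel

/-- The functional enters the boundary only through the scalars `f x`, which contribute a
contraction. So the boundary is affine in `f`; its continuity in `f` and its behaviour under flows
both rest on this. -/
theorem bd_add (ρ : L →ₗ[ℂ] E →L[ℂ] E) (f g : Module.Dual ℂ L) (p : ℕ) :
    bd ρ (f + g) p = bd ρ f p - ccontr E p g := by
  induction p with
  | zero =>
    refine chain_succ_ext fun x b => ?_
    rw [LinearMap.sub_apply, bd_cwedge_zero, bd_cwedge_zero, ccontr_cwedge_zero,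
      LinearMap.add_apply, add_smul]
    abel
  | succ p ih =>
    refine chain_succ_ext fun x b => ?_
    rw [LinearMap.sub_apply, bd_cwedge, bd_cwedge, ccontr_cwedge, ih,
      LinearMap.add_apply, add_smul, LinearMap.sub_apply, map_sub]
    abel

/-- The commutator of a derivation with the boundary. -/
theorem lieOp_bd (ρ : L →ₗ[ℂ] E →L[ℂ] E) (f : Module.Dual ℂ L) (R : E →L[ℂ] E) (δ : L →ₗ[ℂ] L)
    (hδ : ∀ x y, δ ⁅x, y⁆ = ⁅δ x, y⁆ + ⁅x, δ y⁆)
    (hR : ∀ y e, ρ (δ y) e = ρ y (R e) - R (ρ y e)) (p : ℕ) (b : Chain L E (p + 1)) :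
    lieOp R δ p (bd ρ f p b) = bd ρ f p (lieOp R δ (p + 1) b) - ccontr E p (f ∘ₗ δ) b := by
  have key : ∀ (p : ℕ) (y : L) (b : Chain L E p), lieOp R δ p (lieOp (ρ y) (adL y) p b) =
      lieOp (ρ y) (adL y) p (lieOp R δ p b) - lieOp (ρ (δ y)) (adL (δ y)) p b := fun p y b =>
    lieOp_comm R (ρ y) (ρ (δ y)) δ (adL y) (adL (δ y)) (hR y)
      (fun x => by simp [hδ]) p b
  suffices h : lieOp R δ p ∘ₗ bd ρ f p = bd ρ f p ∘ₗ lieOp R δ (p + 1) - ccontr E p (f ∘ₗ δ) from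
    LinearMap.congr_fun h b
  clear b
  induction p with
  | zero =>
    refine chain_succ_ext fun x b => ?_
    simp only [LinearMap.comp_apply, LinearMap.sub_apply, bd_cwedge_zero, lieOp_cwedge, map_sub,
      key, ccontr_cwedge_zero, map_smul]
    abel
  | succ p ih =>
    refine chain_succ_ext fun x b => ?_
    have ih' := LinearMap.congr_fun ih b
    simp only [LinearMap.comp_apply, LinearMap.sub_apply] at ih'
    simp only [LinearMap.comp_apply, LinearMap.sub_apply, bd_cwedge, lieOp_cwedge, map_sub,
      key, ccontr_cwedge, map_smul, ih']
    abel

/-- Inner derivations commute with the boundary of a character. -/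
theorem lieOp_ad_bd (ρ : L →ₗ[ℂ] E →L[ℂ] E) (hρ : IsRightAction ρ) (f : Module.Dual ℂ L)
    (hf : f ∈ characters L) (x : L) (p : ℕ) (b : Chain L E (p + 1)) :
    lieOp (ρ x) (adL x) p (bd ρ f p b) = bd ρ f p (lieOp (ρ x) (adL x) (p + 1) b) := by
  rw [lieOp_bd ρ f (ρ x) (adL x) (fun y z => by simp) (fun y e => hρ x y e)]
  have : f ∘ₗ adL x = 0 := LinearMap.ext fun y => hf x y
  rw [this]
  have h0 : ccontr E p (0 : Module.Dual ℂ L) = 0 := by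
    simpa using ccontr_smul (E := E) p 0 (0 : Module.Dual ℂ L)
  rw [h0]
  simp

/-- Induction by Cartan's formula: applied twice to `x ∧ b` it leaves the commutator of the boundary
with the Lie derivative along `x`, which vanishes for a character, and the square of the boundary on
`b`. -/
theorem bd_bd (ρ : L →ₗ[ℂ] E →L[ℂ] E) (hρ : IsRightAction ρ) (f : Module.Dual ℂ L)
    (hf : f ∈ characters L) (p : ℕ) (b : Chain L E (p + 2)) :
    bd ρ f p (bd ρ f (p + 1) b) = 0 := by
  suffices h : bd ρ f p ∘ₗ bd ρ f (p + 1) = 0 from LinearMap.congr_fun h b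
  clear b
  induction p with
  | zero =>
    refine chain_succ_ext fun x b => ?_
    simp only [LinearMap.comp_apply, bd_cwedge, map_sub, bd_cwedge_zero, map_smul,
      lieOp_ad_bd ρ hρ f hf, LinearMap.zero_apply]
    abel
  | succ p ih =>
    refine chain_succ_ext fun x b => ?_
    have ih' := LinearMap.congr_fun ih b
    simp only [LinearMap.comp_apply, LinearMap.zero_apply] at ih'
    simp only [LinearMap.comp_apply, bd_cwedge, map_sub, map_smul,
      lieOp_ad_bd ρ hρ f hf, LinearMap.zero_apply, ih', map_zero]
    abel

end Lie

/-! ### Functoriality of chains in the Lie algebra. -/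

section Functoriality

variable {A : Type*} [LieRing A] [LieAlgebra ℂ A]

/-- The map on chains induced by a linear map of Lie algebras. -/
def cmap (E : Type*) [NormedAddCommGroup E] [NormedSpace ℂ E] (g : A →ₗ[ℂ] L) (p : ℕ) :
    Chain A E p →ₗ[ℂ] Chain L E p :=
  LinearMap.lTensor E (exteriorPower.map p g)

@[simp] theorem cmap_tmul (g : A →ₗ[ℂ] L) (p : ℕ) (e : E) (b : ⋀[ℂ]^p A) :
    cmap E g p (e ⊗ₜ b) = e ⊗ₜ exteriorPower.map p g b := rfl

theorem cmap_cwedge (g : A →ₗ[ℂ] L) (p : ℕ) (x : A) (b : Chain A E p) :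
    cmap E g (p + 1) (cwedge E p x b) = cwedge E p (g x) (cmap E g p b) := by
  suffices h : cmap E g (p + 1) ∘ₗ cwedge E p x = cwedge E p (g x) ∘ₗ cmap E g p from
    LinearMap.congr_fun h b
  refine TensorProduct.ext' fun e b => ?_
  simp [map_wedge]

theorem cmap_cmap {B : Type*} [LieRing B] [LieAlgebra ℂ B] (g : A →ₗ[ℂ] L) (h : B →ₗ[ℂ] A)
    (p : ℕ) (b : Chain B E p) : cmap E g p (cmap E h p b) = cmap E (g ∘ₗ h) p b := by
  rw [cmap, cmap, cmap, exteriorPower.map_comp, LinearMap.lTensor_comp, LinearMap.comp_apply]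

theorem cmap_id (p : ℕ) (b : Chain A E p) : cmap E (LinearMap.id : A →ₗ[ℂ] A) p b = b := by
  simp [cmap, exteriorPower.map_id]

theorem cmap_degree_zero (g : L →ₗ[ℂ] L) (b : Chain L E 0) : cmap E g 0 b = b := by
  suffices H : cmap E g 0 = LinearMap.id from LinearMap.congr_fun H b
  refine chain_ext fun e v => ?_
  simp only [cmap_tmul, exteriorPower.map_apply_ιMulti, LinearMap.id_apply]
  congr 2
  exact Subsingleton.elim _ _

/-- `⋀(id - φ ⊗ x) = id - (x ∧ ·) ι_φ`. -/
theorem cmap_projection (g : L →ₗ[ℂ] L) (φ : Module.Dual ℂ L) (x : L)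
    (hg : ∀ y, g y = y - φ y • x) (p : ℕ) (b : Chain L E (p + 1)) :
    cmap E g (p + 1) b = b - cwedge E p x (ccontr E p φ b) := by
  suffices H : cmap E g (p + 1) = LinearMap.id - cwedge E p x ∘ₗ ccontr E p φ from
    LinearMap.congr_fun H b
  clear b
  have hs : ∀ (p : ℕ) (c : ℂ) (b : Chain L E p), cwedge E p (c • x) b = c • cwedge E p x b :=
    fun p c b => by simp [cwedge, wedge_smul, LinearMap.lTensor_smul]
  induction p with
  | zero =>
    refine chain_succ_ext fun y b => ?_
    simp only [cmap_cwedge, LinearMap.sub_apply, LinearMap.comp_apply, LinearMap.id_apply,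
      ccontr_cwedge_zero, hg, cmap_degree_zero, cwedge_sub, hs, map_smul]
  | succ p ih =>
    refine chain_succ_ext fun y b => ?_
    simp only [cmap_cwedge, LinearMap.sub_apply, LinearMap.comp_apply, LinearMap.id_apply,
      ccontr_cwedge, hg, ih, cwedge_sub, hs, map_smul, map_sub, cwedge_self]
    rw [cwedge_swap p x y]
    module

variable [FiniteDimensional ℂ L] [FiniteDimensional ℂ A]

theorem cmap_lieOp (g : A →ₗ[ℂ] L) (R : E →L[ℂ] E) (δ : A →ₗ[ℂ] A) (δ' : L →ₗ[ℂ] L)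
    (h : ∀ y, g (δ y) = δ' (g y)) (p : ℕ) (b : Chain A E p) :
    cmap E g p (lieOp R δ p b) = lieOp R δ' p (cmap E g p b) := by
  suffices H : cmap E g p ∘ₗ lieOp R δ p = lieOp R δ' p ∘ₗ cmap E g p from
    LinearMap.congr_fun H b
  refine TensorProduct.ext' fun e b => ?_
  simp [lieOp_tmul, map_extDer g δ δ' h]

theorem cmap_bd (ρ : L →ₗ[ℂ] E →L[ℂ] E) (f : Module.Dual ℂ L) (g : A →ₗ⁅ℂ⁆ L) (p : ℕ)
    (b : Chain A E (p + 1)) :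
    cmap E (g : A →ₗ[ℂ] L) p (bd (ρ ∘ₗ (g : A →ₗ[ℂ] L)) (f ∘ₗ (g : A →ₗ[ℂ] L)) p b) =
      bd ρ f p (cmap E (g : A →ₗ[ℂ] L) (p + 1) b) := by
  suffices H : cmap E (g : A →ₗ[ℂ] L) p ∘ₗ bd (ρ ∘ₗ (g : A →ₗ[ℂ] L)) (f ∘ₗ (g : A →ₗ[ℂ] L)) p =
      bd ρ f p ∘ₗ cmap E (g : A →ₗ[ℂ] L) (p + 1) from LinearMap.congr_fun H b
  clear b
  have hl : ∀ (p : ℕ) (x : A) (b : Chain A E p), cmap E (g : A →ₗ[ℂ] L) p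
      (lieOp (ρ (g x)) (adL x) p b) = lieOp (ρ (g x)) (adL (g x)) p (cmap E (g : A →ₗ[ℂ] L) p b) :=
    fun p x b => cmap_lieOp _ _ _ _ (fun y => by simp) p b
  induction p with
  | zero =>
    refine chain_succ_ext fun x b => ?_
    simp only [LinearMap.comp_apply, bd_cwedge_zero, cmap_cwedge, map_sub, map_smul,
      LieHom.coe_toLinearMap, hl]
  | succ p ih =>
    refine chain_succ_ext fun x b => ?_
    have ih' := LinearMap.congr_fun ih b
    simp only [LinearMap.comp_apply] at ih'
    simp only [LinearMap.comp_apply, bd_cwedge, cmap_cwedge, map_sub, map_smul,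
      LieHom.coe_toLinearMap, hl, ih']

end Functoriality

end ChainAlgebra

/-! ### Strict exactness of complexes of Banach spaces. -/

section Analysis

open Filter

variable {X Y Z X' Y' Z' : Type*}
  [NormedAddCommGroup X] [NormedSpace ℂ X] [NormedAddCommGroup Y] [NormedSpace ℂ Y]
  [NormedAddCommGroup Z] [NormedSpace ℂ Z]
  [NormedAddCommGroup X'] [NormedSpace ℂ X'] [NormedAddCommGroup Y'] [NormedSpace ℂ Y']
  [NormedAddCommGroup Z'] [NormedSpace ℂ Z']

/-- Quantitative exactness of `X → Y → Z` at `Y`. For a complex of Banach spaces it means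
exactness at `Y` together with closedness of the range of `B`, see `strictExact_iff`. -/
def StrictExact (A : X →ₗ[ℂ] Y) (B : Y →ₗ[ℂ] Z) : Prop :=
  ∃ c : ℝ, 0 < c ∧ ∀ y, ∃ x, ‖x‖ ≤ c * ‖y‖ ∧ ‖y - A x‖ ≤ c * ‖B y‖

theorem StrictExact.of_subsingleton [Subsingleton Y] (A : X →ₗ[ℂ] Y) (B : Y →ₗ[ℂ] Z) :
    StrictExact A B :=
  ⟨1, one_pos, fun y => ⟨0, by simp, by simp [Subsingleton.elim y 0]⟩⟩

/-- Successive approximation: replacing `y` by `y - A (s y)` keeps `B y` unchanged and halves the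
norm up to the error `c * ‖B y‖`. An approximate solution therefore improves to one without the term
`1 / 2 * ‖y‖`. -/
theorem strictExact_of_approx [CompleteSpace X] (A : X →L[ℂ] Y) (B : Y →ₗ[ℂ] Z)
    (hBA : ∀ x, B (A x) = 0) {c : ℝ} (hc : 0 < c)
    (h : ∀ y, ∃ x, ‖x‖ ≤ c * ‖y‖ ∧ ‖y - A x‖ ≤ c * ‖B y‖ + 1 / 2 * ‖y‖) :
    StrictExact (A : X →ₗ[ℂ] Y) B := by
  choose s hs1 hs2 using h
  refine ⟨4 * c, by positivity, fun y => ?_⟩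
  let u : ℕ → Y := fun n => Nat.rec y (fun _ v => v - A (s v)) n
  have u0 : u 0 = y := rfl
  have us : ∀ n, u (n + 1) = u n - A (s (u n)) := fun n => rfl
  have hB : ∀ n, B (u n) = B y := by
    intro n
    induction n with
    | zero => rfl
    | succ n ih => rw [us, map_sub, hBA, sub_zero, ih]
  have hsum : ∀ n, u n = y - A (∑ i ∈ Finset.range n, s (u i)) := by
    intro n
    induction n with
    | zero => simp [u0]
    | succ n ih => rw [us, Finset.sum_range_succ, map_add, ← sub_sub, ← ih]
  -- Above the threshold `4 * c * ‖B y‖` the error `c * ‖B y‖` is at most a quarter of the norm, so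
  -- each step contracts by `1/2 + 1/4 = 3/4`.
  have hdec : ∀ n, (∀ i < n, ¬ ‖u i‖ ≤ 4 * c * ‖B y‖) → ‖u n‖ ≤ (3 / 4) ^ n * ‖y‖ := by
    intro n
    induction n with
    | zero => intro _; simp [u0]
    | succ n ih =>
      intro hn
      have h1 := ih fun i hi => hn i (by omega)
      have h2 := hn n (by omega)
      have h3 := hs2 (u n)
      rw [hB] at h3
      rw [us, pow_succ]
      linarith
  have hgeom : ∀ n, ∑ i ∈ Finset.range n, (3 / 4 : ℝ) ^ i ≤ 4 := by
    intro n
    have h1 : Summable fun i : ℕ => (3 / 4 : ℝ) ^ i :=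
      summable_geometric_of_lt_one (by norm_num) (by norm_num)
    have h2 := h1.sum_le_tsum (Finset.range n) (fun i _ => by positivity)
    rw [tsum_geometric_of_lt_one (by norm_num) (by norm_num)] at h2
    norm_num at h2 ⊢
    exact h2
  -- Either stop at the first iterate below the threshold, or all iterates stay above it; then they
  -- tend to zero and the full series is an exact preimage of `y`.
  by_cases hex : ∃ n, ‖u n‖ ≤ 4 * c * ‖B y‖
  · classical
    let n := Nat.find hex
    have hn : ‖u n‖ ≤ 4 * c * ‖B y‖ := Nat.find_spec hex
    have hlt : ∀ i < n, ¬ ‖u i‖ ≤ 4 * c * ‖B y‖ := fun i hi => Nat.find_min hex hi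
    refine ⟨∑ i ∈ Finset.range n, s (u i), ?_, ?_⟩
    · calc ‖∑ i ∈ Finset.range n, s (u i)‖ ≤ ∑ i ∈ Finset.range n, c * ((3 / 4) ^ i * ‖y‖) := by
            refine norm_sum_le_of_le _ fun i hi => (hs1 _).trans ?_
            gcongr
            exact hdec i fun j hj => hlt j (hj.trans (Finset.mem_range.1 hi))
        _ = (∑ i ∈ Finset.range n, (3 / 4 : ℝ) ^ i) * (c * ‖y‖) := by
            rw [Finset.sum_mul]
            exact Finset.sum_congr rfl fun i _ => by ring
        _ ≤ 4 * (c * ‖y‖) := by gcongr; exact hgeom n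
        _ = 4 * c * ‖y‖ := by ring
    · have := hsum n
      simp only [ContinuousLinearMap.coe_coe]
      rwa [← this]
  · push Not at hex
    have hb : ∀ n, ‖u n‖ ≤ (3 / 4) ^ n * ‖y‖ := fun n => hdec n fun i _ => not_le.2 (hex i)
    have hsb : ∀ n, ‖s (u n)‖ ≤ c * ‖y‖ * (3 / 4) ^ n := fun n => (hs1 _).trans (by
      calc c * ‖u n‖ ≤ c * ((3 / 4) ^ n * ‖y‖) := by gcongr; exact hb n
        _ = _ := by ring)
    have hgs : HasSum (fun n : ℕ => c * ‖y‖ * (3 / 4 : ℝ) ^ n) (c * ‖y‖ * (1 - 3 / 4)⁻¹) :=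
      (hasSum_geometric_of_lt_one (by norm_num) (by norm_num)).mul_left _
    have hS : Summable fun n => s (u n) := Summable.of_norm_bounded hgs.summable hsb
    refine ⟨∑' n, s (u n), ?_, ?_⟩
    · refine (tsum_of_norm_bounded hgs hsb).trans (le_of_eq ?_)
      norm_num
      ring
    · have h1 : Tendsto u atTop (𝓝 (y - A (∑' n, s (u n)))) := by
        refine Tendsto.congr (fun n => (hsum n).symm) ?_
        exact tendsto_const_nhds.sub ((A.continuous.tendsto _).comp hS.hasSum.tendsto_sum_nat)
      have h2 : Tendsto u atTop (𝓝 0) := by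
        refine squeeze_zero_norm hb ?_
        simpa using (tendsto_pow_atTop_nhds_zero_of_lt_one (r := (3 / 4 : ℝ)) (by norm_num)
          (by norm_num)).mul_const ‖y‖
      rw [ContinuousLinearMap.coe_coe, tendsto_nhds_unique h1 h2, norm_zero]
      positivity

/-- Quantitative exactness is stable under small perturbations of the complex. -/
theorem StrictExact.perturb [CompleteSpace X] {A : X →L[ℂ] Y} {B : Y →L[ℂ] Z}
    (h : StrictExact (A : X →ₗ[ℂ] Y) (B : Y →ₗ[ℂ] Z)) :
    ∃ ε > 0, ∀ (A' : X →L[ℂ] Y) (B' : Y →L[ℂ] Z), (∀ x, B' (A' x) = 0) →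
      ‖A' - A‖ < ε → ‖B' - B‖ < ε → StrictExact (A' : X →ₗ[ℂ] Y) (B' : Y →ₗ[ℂ] Z) := by
  obtain ⟨c, hc, h⟩ := h
  -- With this radius the changes of `A` and of `B` each cost `1/4 * ‖y‖`, together the `1/2 * ‖y‖`
  -- allowed by `strictExact_of_approx`.
  refine ⟨1 / (4 * c), by positivity, fun A' B' hBA hA hB => ?_⟩
  refine strictExact_of_approx A' (B' : Y →ₗ[ℂ] Z) hBA hc fun y => ?_
  obtain ⟨x, hx1, hx2⟩ := h y
  refine ⟨x, hx1, ?_⟩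
  have e1 : ‖A' x - A x‖ ≤ 1 / (4 * c) * (c * ‖y‖) := by
    calc ‖A' x - A x‖ = ‖(A' - A) x‖ := rfl
      _ ≤ ‖A' - A‖ * ‖x‖ := (A' - A).le_opNorm x
      _ ≤ _ := by gcongr
  have e2 : ‖B' y - B y‖ ≤ 1 / (4 * c) * ‖y‖ := by
    calc ‖B' y - B y‖ = ‖(B' - B) y‖ := rfl
      _ ≤ ‖B' - B‖ * ‖y‖ := (B' - B).le_opNorm y
      _ ≤ _ := by gcongr
  have e3 : ‖B y‖ ≤ ‖B' y‖ + ‖B' y - B y‖ := by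
    have := norm_sub_le (B' y) (B' y - B y)
    simpa using this
  have e4 : ‖y - A' x‖ ≤ ‖y - A x‖ + ‖A' x - A x‖ := by
    have := norm_sub_le (y - A x) (A' x - A x)
    simpa using this
  have e5 : 1 / (4 * c) * (c * ‖y‖) = 1 / 4 * ‖y‖ := by field_simp
  have e6 : c * ‖B y‖ ≤ c * ‖B' y‖ + 1 / 4 * ‖y‖ := by
    have : c * ‖B y‖ ≤ c * (‖B' y‖ + 1 / (4 * c) * ‖y‖) := by gcongr; linarith
    refine this.trans (le_of_eq ?_)
    field_simp
  simp only [ContinuousLinearMap.coe_coe] at hx2 ⊢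
  linarith

theorem StrictExact.range_eq_ker {A : X →ₗ[ℂ] Y} {B : Y →ₗ[ℂ] Z} (h : StrictExact A B)
    (hBA : ∀ x, B (A x) = 0) : LinearMap.range A = LinearMap.ker B := by
  obtain ⟨c, hc, h⟩ := h
  refine le_antisymm ?_ fun y hy => ?_
  · rintro _ ⟨x, rfl⟩
    exact hBA x
  · obtain ⟨x, -, hx⟩ := h y
    rw [LinearMap.mem_ker.1 hy, norm_zero, mul_zero] at hx
    exact ⟨x, (sub_eq_zero.1 (norm_le_zero_iff.1 hx)).symm⟩

/-- Since `A x` lies in the kernel of `B`, the estimate bounds the distance from `y` to that kernel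
by `c * ‖B y‖`. Hence the map induced on the quotient by the kernel is bounded below. -/
theorem StrictExact.isClosed_range [CompleteSpace Y] {A : X →ₗ[ℂ] Y} {B : Y →L[ℂ] Z}
    (h : StrictExact A (B : Y →ₗ[ℂ] Z)) (hBA : ∀ x, B (A x) = 0) :
    IsClosed (LinearMap.range (B : Y →ₗ[ℂ] Z) : Set Z) := by
  obtain ⟨c, hc, h⟩ := h
  let K : Submodule ℂ Y := LinearMap.ker (B : Y →ₗ[ℂ] Z)
  have : IsClosed (K : Set Y) := B.isClosed_ker
  let Bq : (Y ⧸ K) →L[ℂ] Z := K.liftQL B le_rfl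
  have hBq : ∀ y, Bq (Submodule.Quotient.mk y) = B y := fun y => rfl
  have hanti : AntilipschitzWith ⟨c, hc.le⟩ Bq := by
    refine AddMonoidHomClass.antilipschitz_of_bound Bq fun q => ?_
    obtain ⟨y, rfl⟩ := Submodule.Quotient.mk_surjective K q
    obtain ⟨x, -, hx⟩ := h y
    have : (Submodule.Quotient.mk y : Y ⧸ K) = Submodule.Quotient.mk (y - A x) := by
      rw [Submodule.Quotient.eq]
      simp [K, hBA]
    rw [hBq]
    calc ‖(Submodule.Quotient.mk y : Y ⧸ K)‖ = ‖(Submodule.Quotient.mk (y - A x) : Y ⧸ K)‖ := by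
          rw [this]
      _ ≤ ‖y - A x‖ := Submodule.Quotient.norm_mk_le K _
      _ ≤ _ := hx
  have hcl := hanti.isClosed_range Bq.uniformContinuous
  convert hcl using 1
  ext z
  constructor
  · rintro ⟨y, rfl⟩
    exact ⟨Submodule.Quotient.mk y, rfl⟩
  · rintro ⟨q, rfl⟩
    obtain ⟨y, rfl⟩ := Submodule.Quotient.mk_surjective K q
    exact ⟨y, rfl⟩

theorem exists_preimage_norm_le_of_isClosed_range [CompleteSpace X] [CompleteSpace Y]
    (A : X →L[ℂ] Y) (h : IsClosed (LinearMap.range (A : X →ₗ[ℂ] Y) : Set Y)) :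
    ∃ c > 0, ∀ x, ∃ x', A x' = A x ∧ ‖x'‖ ≤ c * ‖A x‖ := by
  let R : Submodule ℂ Y := LinearMap.range (A : X →ₗ[ℂ] Y)
  have : CompleteSpace R := h.completeSpace_coe
  let A' : X →L[ℂ] R := A.codRestrict R fun x => ⟨x, rfl⟩
  have hs : Function.Surjective A' := by
    rintro ⟨_, x, rfl⟩
    exact ⟨x, rfl⟩
  obtain ⟨c, hc, h⟩ := A'.exists_preimage_norm_le hs
  refine ⟨c, hc, fun x => ?_⟩
  obtain ⟨x', hx', hn⟩ := h (A' x)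
  exact ⟨x', congrArg Subtype.val hx', hn⟩

/-- Two uses of the open mapping theorem: lift `B y` to a small `y'`, then lift the cycle `y - y'`
through `A`, whose range is closed because it is a kernel. -/
theorem strictExact_of_range_eq_ker [CompleteSpace X] [CompleteSpace Y] [CompleteSpace Z]
    {A : X →L[ℂ] Y} {B : Y →L[ℂ] Z}
    (h : LinearMap.range (A : X →ₗ[ℂ] Y) = LinearMap.ker (B : Y →ₗ[ℂ] Z))
    (hB : IsClosed (LinearMap.range (B : Y →ₗ[ℂ] Z) : Set Z)) :
    StrictExact (A : X →ₗ[ℂ] Y) (B : Y →ₗ[ℂ] Z) := by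
  have hA : IsClosed (LinearMap.range (A : X →ₗ[ℂ] Y) : Set Y) := by
    rw [h]
    exact B.isClosed_ker
  obtain ⟨a, ha, hA⟩ := exists_preimage_norm_le_of_isClosed_range A hA
  obtain ⟨b, hb, hB⟩ := exists_preimage_norm_le_of_isClosed_range B hB
  refine ⟨max b (a * (1 + b * ‖B‖)), by positivity, fun y => ?_⟩
  obtain ⟨y', hy', hn⟩ := hB y
  have hmem : y - y' ∈ LinearMap.range (A : X →ₗ[ℂ] Y) := by
    rw [h]
    simp [hy']
  obtain ⟨x, hx⟩ := hmem
  obtain ⟨x', hx', hn'⟩ := hA x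
  have hx'' : A x' = y - y' := hx'.trans hx
  refine ⟨x', ?_, ?_⟩
  · have e1 : ‖y'‖ ≤ b * (‖B‖ * ‖y‖) := hn.trans (by gcongr; exact B.le_opNorm y)
    calc ‖x'‖ ≤ a * ‖A x‖ := hn'
      _ = a * ‖y - y'‖ := by rw [← hx', hx'']
      _ ≤ a * (‖y‖ + b * (‖B‖ * ‖y‖)) := by gcongr; exact (norm_sub_le _ _).trans (by gcongr)
      _ = a * (1 + b * ‖B‖) * ‖y‖ := by ring
      _ ≤ _ := by gcongr; exact le_max_right _ _
  · simp only [ContinuousLinearMap.coe_coe, hx'', sub_sub_cancel]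
    exact hn.trans (by gcongr; exact le_max_left _ _)

/-- Transport of quantitative exactness along bounded maps between complexes which are bijective
in the middle. -/
theorem StrictExact.transport {A : X →ₗ[ℂ] Y} {B : Y →ₗ[ℂ] Z} {A' : X' →ₗ[ℂ] Y'}
    {B' : Y' →ₗ[ℂ] Z'} (h : StrictExact A B) (u : X →L[ℂ] X') (v : Y →L[ℂ] Y') (w : Y' →L[ℂ] Y)
    (hvw : ∀ y, v (w y) = y) (hA : ∀ x, v (A x) = A' (u x)) {c : ℝ}
    (hB : ∀ y, ‖B (w y)‖ ≤ c * ‖B' y‖) : StrictExact A' B' := by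
  obtain ⟨b, hb, h⟩ := h
  have hc : 0 ≤ max c 0 := le_max_right _ _
  refine ⟨max 1 (max (‖u‖ * (b * ‖w‖)) (‖v‖ * (b * max c 0))), by positivity, fun y => ?_⟩
  obtain ⟨x, hx1, hx2⟩ := h (w y)
  refine ⟨u x, ?_, ?_⟩
  · calc ‖u x‖ ≤ ‖u‖ * ‖x‖ := u.le_opNorm x
      _ ≤ ‖u‖ * (b * (‖w‖ * ‖y‖)) := by
        gcongr
        exact hx1.trans (by gcongr; exact w.le_opNorm y)
      _ = ‖u‖ * (b * ‖w‖) * ‖y‖ := by ring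
      _ ≤ _ := by gcongr; exact (le_max_left _ _).trans (le_max_right _ _)
  · calc ‖y - A' (u x)‖ = ‖v (w y - A x)‖ := by rw [map_sub, hvw, hA]
      _ ≤ ‖v‖ * ‖w y - A x‖ := v.le_opNorm _
      _ ≤ ‖v‖ * (b * (max c 0 * ‖B' y‖)) := by
        gcongr
        refine hx2.trans ?_
        gcongr
        refine (hB y).trans ?_
        gcongr
        exact le_max_left _ _
      _ = ‖v‖ * (b * max c 0) * ‖B' y‖ := by ring
      _ ≤ _ := by gcongr; exact (le_max_right _ _).trans (le_max_right _ _)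

/-- A complex on which a large multiple of the identity is homotopic to a bounded endomorphism is
strictly exact. -/
theorem StrictExact.of_homotopy [CompleteSpace X] [CompleteSpace Y] {A : X →ₗ[ℂ] Y}
    {B : Y →ₗ[ℂ] Z} (a : ℂ) (S : X →L[ℂ] X) (T : Y →L[ℂ] Y) (H : Y →L[ℂ] X) (K : Z →L[ℂ] Y)
    (hS : ‖S‖ * ‖(1 : X →L[ℂ] X)‖ < ‖a‖) (hT : ‖T‖ * ‖(1 : Y →L[ℂ] Y)‖ < ‖a‖)
    (hA : ∀ x, A (S x) = T (A x))
    (hH : ∀ y, T y - a • y = A (H y) + K (B y)) : StrictExact A B := by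
  obtain ⟨s, hs⟩ := spectrum.mem_resolventSet_of_norm_lt_mul hS
  obtain ⟨t, ht⟩ := spectrum.mem_resolventSet_of_norm_lt_mul hT
  have hs' : ∀ x, s.1 x = a • x - S x := fun x => by rw [hs]; rfl
  have ht' : ∀ y, t.1 y = a • y - T y := fun y => by rw [ht]; rfl
  have hst : ∀ x, A (s⁻¹.1 x) = t⁻¹.1 (A x) := by
    intro x
    have h1 : s.1 (s⁻¹.1 x) = x := by
      rw [← mul_apply_eq_comp, Units.mul_inv, one_apply_eq_self]
    have h2 : ∀ z, t⁻¹.1 (t.1 z) = z := fun z => by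
      rw [← mul_apply_eq_comp, Units.inv_mul, one_apply_eq_self]
    rw [← h2 (A (s⁻¹.1 x)), ht', ← hA, ← map_smul, ← map_sub, ← hs', h1]
  refine ⟨max 1 (max (‖s⁻¹.1‖ * ‖H‖) (‖t⁻¹.1‖ * ‖K‖)), by positivity, fun y => ?_⟩
  -- Here `s = a - S` and `t = a - T` are invertible. The homotopy reads `-t y = A (H y) + K (B y)`;
  -- apply `-t⁻¹` and move it past `A` as `s⁻¹`.
  refine ⟨-s⁻¹.1 (H y), ?_, ?_⟩
  · calc ‖-s⁻¹.1 (H y)‖ = ‖s⁻¹.1 (H y)‖ := norm_neg _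
      _ ≤ ‖s⁻¹.1‖ * (‖H‖ * ‖y‖) := s⁻¹.1.le_opNorm_of_le (H.le_opNorm y)
      _ = ‖s⁻¹.1‖ * ‖H‖ * ‖y‖ := by ring
      _ ≤ _ := by gcongr; exact (le_max_left _ _).trans (le_max_right _ _)
  · have h2 : t⁻¹.1 (t.1 y) = y := by
      rw [← mul_apply_eq_comp, Units.inv_mul, one_apply_eq_self]
    have h3 : y - A (-s⁻¹.1 (H y)) = -t⁻¹.1 (K (B y)) := by
      rw [map_neg, hst, sub_neg_eq_add, ← eq_sub_iff_add_eq]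
      conv_lhs => rw [← h2, ht', ← neg_sub, hH]
      rw [map_neg, map_add]
      abel
    rw [h3, norm_neg]
    calc ‖t⁻¹.1 (K (B y))‖ ≤ ‖t⁻¹.1‖ * (‖K‖ * ‖B y‖) := t⁻¹.1.le_opNorm_of_le (K.le_opNorm _)
      _ = ‖t⁻¹.1‖ * ‖K‖ * ‖B y‖ := by ring
      _ ≤ _ := by gcongr; exact (le_max_right _ _).trans (le_max_right _ _)

end Analysis

/-! ### Approximate eigenvalues, mapping cones and one parameter groups. -/

section Spectral

open Filter

variable {F Q Z C₀ C₁ C₂ X Y V : Type*}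
  [NormedAddCommGroup F] [NormedSpace ℂ F] [NormedAddCommGroup Q] [NormedSpace ℂ Q]
  [NormedAddCommGroup Z] [NormedSpace ℂ Z] [NormedAddCommGroup C₀] [NormedSpace ℂ C₀]
  [NormedAddCommGroup C₁] [NormedSpace ℂ C₁] [NormedAddCommGroup C₂] [NormedSpace ℂ C₂]
  [NormedAddCommGroup X] [NormedSpace ℂ X] [NormedAddCommGroup Y] [NormedSpace ℂ Y]
  [NormedAddCommGroup V] [NormedSpace ℂ V]

/-- A bounded operator on a nonzero Banach space has an approximate eigenvalue. -/
theorem subsingleton_of_forall_bounded_below [CompleteSpace F] (T : F →L[ℂ] F)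
    (h : ∀ μ : ℂ, ∃ c > 0, ∀ q, ‖q‖ ≤ c * ‖T q - μ • q‖) : Subsingleton F := by
  by_contra hF
  rw [not_subsingleton_iff_nontrivial] at hF
  have hopen := spectrum.isOpen_resolventSet (𝕜 := ℂ) T
  -- The lower bound at `μ` bounds the resolvents at nearby points `ν` of the resolvent set by `2 *
  -- c`, so their Neumann series reach `μ`. A clopen subset of `ℂ` is empty or everything, and the
  -- spectrum is both bounded and nonempty.
  have hclosed : IsClosed (resolventSet ℂ T) := by
    rw [← closure_subset_iff_isClosed]
    intro μ hμ
    obtain ⟨c, hc, hb⟩ := h μ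
    obtain ⟨ν, ⟨u, hu⟩, hd⟩ := Metric.mem_closure_iff.1 hμ (1 / (2 * c)) (by positivity)
    rw [dist_eq_norm] at hd
    have hu' : ∀ q, u.1 q = ν • q - T q := fun q => by rw [hu]; rfl
    have hinv : ‖u⁻¹.1‖ ≤ 2 * c := by
      refine ContinuousLinearMap.opNorm_le_bound _ (by positivity) fun q => ?_
      have e1 : u.1 (u⁻¹.1 q) = q := by
        rw [← mul_apply_eq_comp, Units.mul_inv, one_apply_eq_self]
      have e2 := hb (u⁻¹.1 q)
      have e3 : T (u⁻¹.1 q) - μ • u⁻¹.1 q = -q - (μ - ν) • u⁻¹.1 q := by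
        rw [hu', sub_eq_iff_eq_add] at e1
        rw [sub_smul, e1]
        abel
      rw [e3] at e2
      have e4 : ‖-q - (μ - ν) • u⁻¹.1 q‖ ≤ ‖q‖ + 1 / (2 * c) * ‖u⁻¹.1 q‖ := by
        refine (norm_sub_le _ _).trans ?_
        rw [norm_neg, norm_smul]
        gcongr
      have e5 : c * (‖q‖ + 1 / (2 * c) * ‖u⁻¹.1 q‖) = c * ‖q‖ + 1 / 2 * ‖u⁻¹.1 q‖ := by
        field_simp
      have e6 : ‖u⁻¹.1 q‖ ≤ c * ‖q‖ + 1 / 2 * ‖u⁻¹.1 q‖ := e2.trans (by rw [← e5]; gcongr)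
      linarith
    have hpos : 0 < ‖u⁻¹.1‖ := norm_pos_iff.2 (Units.ne_zero _)
    refine ⟨Units.ofNearby u (algebraMap ℂ _ μ - T) ?_, rfl⟩
    rw [hu, sub_sub_sub_cancel_right, ← map_sub, norm_algebraMap']
    refine hd.trans_le ?_
    rw [one_div]
    exact inv_anti₀ hpos hinv
  rcases isClopen_iff.1 ⟨hclosed, hopen⟩ with h0 | h1
  · have hb := spectrum.isBounded (𝕜 := ℂ) T
    rw [spectrum, h0, Set.compl_empty] at hb
    exact NoncompactSpace.noncompact_univ (X := ℂ)
      (Metric.isCompact_of_isClosed_isBounded isClosed_univ hb)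
  · obtain ⟨μ, hμ⟩ := spectrum.nonempty T
    exact hμ (h1 ▸ Set.mem_univ μ)

/-- The null sequences among the bounded sequences. -/
def nullSeq (Q : Type*) [NormedAddCommGroup Q] [NormedSpace ℂ Q] :
    Submodule ℂ (BoundedContinuousFunction ℕ Q) where
  carrier := {q | Tendsto q atTop (𝓝 0)}
  add_mem' ha hb := by
    have := Tendsto.add ha hb
    rw [add_zero] at this
    exact this
  zero_mem' := tendsto_const_nhds
  smul_mem' c q hq := by simpa using Tendsto.const_smul hq c

theorem isClosed_nullSeq : IsClosed (nullSeq Q : Set (BoundedContinuousFunction ℕ Q)) := by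
  rw [← closure_subset_iff_isClosed]
  intro q hq
  refine Metric.tendsto_atTop.2 fun ε hε => ?_
  obtain ⟨q', hq', hd⟩ := Metric.mem_closure_iff.1 hq (ε / 2) (by positivity)
  obtain ⟨N, hN⟩ := Metric.tendsto_atTop.1 hq' (ε / 2) (by positivity)
  refine ⟨N, fun n hn => ?_⟩
  have h1 : dist (q n) (q' n) ≤ dist q q' := BoundedContinuousFunction.dist_coe_le_dist n
  have h2 := hN n hn
  have h3 := dist_triangle (q n) (q' n) 0
  linarith

/-- The projection property of the joint approximate point spectrum: if `T` preserves approximate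
kernels of `S` and has no approximate eigenvalue on them, then `S` is bounded below. -/
theorem bounded_below_of_forall_sub_smul [CompleteSpace Q] (T : Q →L[ℂ] Q) (S : Q →L[ℂ] Z)
    {κ : ℝ} (hST : ∀ q, ‖S (T q)‖ ≤ κ * ‖S q‖)
    (h : ∀ μ : ℂ, ∃ c > 0, ∀ q, ‖q‖ ≤ c * (‖T q - μ • q‖ + ‖S q‖)) :
    ∃ c > 0, ∀ q, ‖q‖ ≤ c * ‖S q‖ := by
  -- Approximate kernel vectors of `S` become genuine vectors of the quotient of `W`, the bounded
  -- sequences with `S (q n) → 0`, by its null sequences `N`. On this Banach space `T` induces an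
  -- operator, and the hypothesis says that it has no approximate eigenvalue.
  let W : Submodule ℂ (BoundedContinuousFunction ℕ Q) :=
    (nullSeq Z).comap (S.compLeftContinuousBounded ℕ : _ →ₗ[ℂ] _)
  have hWmem : ∀ q, q ∈ W ↔ Tendsto (fun n => S (q n)) atTop (𝓝 0) := fun q => Iff.rfl
  have hW : IsClosed (W : Set (BoundedContinuousFunction ℕ Q)) :=
    isClosed_nullSeq.preimage (S.compLeftContinuousBounded ℕ).continuous
  have : CompleteSpace W := hW.completeSpace_coe
  let N : Submodule ℂ W := (nullSeq Q).comap W.subtype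
  have hNmem : ∀ q, q ∈ N ↔ Tendsto (fun n => q.1 n) atTop (𝓝 0) := fun q => Iff.rfl
  have hN : IsClosed (N : Set W) := isClosed_nullSeq.preimage continuous_subtype_val
  have hTW : ∀ q ∈ W, T.compLeftContinuousBounded ℕ q ∈ W := by
    intro q hq
    rw [hWmem] at hq ⊢
    refine squeeze_zero_norm (a := fun n => κ * ‖S (q n)‖) (fun n => hST (q n)) ?_
    simpa using hq.norm.const_mul κ
  let TW : W →L[ℂ] W := (T.compLeftContinuousBounded ℕ).restrict hTW
  have hTWa : ∀ w n, (TW w).1 n = T (w.1 n) := fun w n => rfl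
  have hTN : ∀ w ∈ N, TW w ∈ N := by
    intro w hw
    rw [hNmem] at hw ⊢
    simp only [hTWa]
    have := (T.continuous.tendsto 0).comp hw
    rw [map_zero] at this
    exact this
  let TF : (W ⧸ N) →L[ℂ] (W ⧸ N) := N.liftQL (N.mkQL ∘L TW) fun w hw => by
    simpa using hTN w hw
  have hTF : ∀ w, TF (Submodule.Quotient.mk w) = Submodule.Quotient.mk (TW w) := fun w => rfl
  -- Dropping finitely many terms does not change the class, so the quotient norm is controlled by
  -- an eventual bound.
  have htrunc : ∀ (w : W) (C : ℝ), 0 ≤ C → (∀ᶠ n in atTop, ‖w.1 n‖ ≤ C) →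
      ‖(Submodule.Quotient.mk w : W ⧸ N)‖ ≤ C := by
    intro w C hC hw
    obtain ⟨J, hJ⟩ := eventually_atTop.1 hw
    have hbd : ∀ n, ‖(if n < J then 0 else w.1 n)‖ ≤ C := by
      intro n
      split_ifs with hn
      · simpa using hC
      · exact hJ n (by omega)
    let w0 : BoundedContinuousFunction ℕ Q :=
      BoundedContinuousFunction.ofNormedAddCommGroupDiscrete (fun n => if n < J then 0 else w.1 n)
        C hbd
    have hev : ∀ᶠ n in atTop, w.1 n = w0 n := by
      filter_upwards [eventually_ge_atTop J] with n hn
      change w.1 n = if n < J then 0 else w.1 n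
      rw [if_neg (by omega)]
    have hw0 : w0 ∈ W := by
      rw [hWmem]
      refine Tendsto.congr' ?_ ((hWmem _).1 w.2)
      filter_upwards [hev] with n hn
      rw [hn]
    have heq : (Submodule.Quotient.mk w : W ⧸ N) = Submodule.Quotient.mk ⟨w0, hw0⟩ := by
      rw [Submodule.Quotient.eq, hNmem]
      refine tendsto_const_nhds.congr' ?_
      filter_upwards [hev] with n hn
      change 0 = w.1 n - w0 n
      rw [hn, sub_self]
    rw [heq]
    refine (Submodule.Quotient.norm_mk_le N _).trans ?_
    exact (BoundedContinuousFunction.norm_le hC).2 hbd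
  have hsub : Subsingleton (W ⧸ N) := by
    refine subsingleton_of_forall_bounded_below TF fun μ => ?_
    obtain ⟨c, hc, hb⟩ := h μ
    refine ⟨c, hc, fun q => ?_⟩
    obtain ⟨w, rfl⟩ := Submodule.Quotient.mk_surjective N q
    refine le_of_forall_pos_le_add fun ε hε => ?_
    -- Three errors of this size occur: the choice of the representative `w'`, its difference from
    -- `TW w - μ • w`, and the tail of `S (w.1 n)`.
    have hη : 0 < ε / (3 * c) := by positivity
    obtain ⟨w', hw', hn⟩ := Submodule.Quotient.norm_mk_lt
      (TF (Submodule.Quotient.mk w) - μ • Submodule.Quotient.mk w) hη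
    have hnull : w' - (TW w - μ • w) ∈ N := (Submodule.Quotient.eq N).1 hw'
    rw [hNmem] at hnull
    refine htrunc w _ (by positivity) ?_
    have h1 := (Metric.tendsto_atTop.1 hnull _ hη)
    have h2 := (Metric.tendsto_atTop.1 ((hWmem _).1 w.2) _ hη)
    obtain ⟨N1, h1⟩ := h1
    obtain ⟨N2, h2⟩ := h2
    filter_upwards [eventually_ge_atTop N1, eventually_ge_atTop N2] with n hn1 hn2
    have e1 := h1 n hn1
    have e2 := h2 n hn2
    rw [dist_zero_right] at e1 e2
    change ‖w'.1 n - (T (w.1 n) - μ • w.1 n)‖ < _ at e1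
    have e3 : ‖w'.1 n‖ ≤ ‖w'‖ := w'.1.norm_coe_le_norm n
    have e4 : ‖T (w.1 n) - μ • w.1 n‖ ≤
        ‖w'.1 n‖ + ‖w'.1 n - (T (w.1 n) - μ • w.1 n)‖ := by
      have := norm_sub_le (w'.1 n) (w'.1 n - (T (w.1 n) - μ • w.1 n))
      rwa [sub_sub_cancel] at this
    calc ‖w.1 n‖ ≤ c * (‖T (w.1 n) - μ • w.1 n‖ + ‖S (w.1 n)‖) := hb _
      _ ≤ c * (‖TF (Submodule.Quotient.mk w) - μ • Submodule.Quotient.mk w‖ + 3 * (ε / (3 * c))) :=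
        mul_le_mul_of_nonneg_left (by linarith) hc.le
      _ = _ := by field_simp
  by_contra hcon
  push Not at hcon
  -- If no lower bound holds, unit vectors with `S q → 0` give a nonzero class in the quotient,
  -- which has just been shown to be zero.
  have hseq : ∀ n : ℕ, ∃ q, ‖q‖ = 1 ∧ ‖S q‖ ≤ 1 / ((n : ℝ) + 1) := by
    intro n
    obtain ⟨q, hq⟩ := hcon (n + 1) (by positivity)
    have hq0 : 0 < ‖q‖ := lt_of_le_of_lt (by positivity) hq
    refine ⟨((‖q‖⁻¹ : ℝ) : ℂ) • q, ?_, ?_⟩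
    · rw [norm_smul, Complex.norm_real, norm_inv, norm_norm, inv_mul_cancel₀ hq0.ne']
    · rw [map_smul, norm_smul, Complex.norm_real, norm_inv, norm_norm, inv_mul_le_iff₀ hq0,
        mul_one_div, le_div_iff₀ (by positivity)]
      linarith
  choose s hs1 hs2 using hseq
  let w0 : BoundedContinuousFunction ℕ Q :=
    BoundedContinuousFunction.ofNormedAddCommGroupDiscrete s 1 fun n => (hs1 n).le
  have hw0 : w0 ∈ W := by
    rw [hWmem]
    exact squeeze_zero_norm hs2 tendsto_one_div_add_atTop_nhds_zero_nat
  have hz : (Submodule.Quotient.mk ⟨w0, hw0⟩ : W ⧸ N) = 0 := Subsingleton.elim _ _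
  rw [Submodule.Quotient.mk_eq_zero, hNmem] at hz
  have h1 : Tendsto (fun n => ‖s n‖) atTop (𝓝 0) := by
    have := hz.norm
    rw [norm_zero] at this
    exact this
  simp only [hs1] at h1
  exact one_ne_zero (tendsto_nhds_unique tendsto_const_nhds h1)

/-- If the mapping cones of `Θ - μ` are strictly exact for all `μ`, then strict exactness of the
complex descends by one degree. -/
theorem StrictExact.descend [CompleteSpace C₀] [CompleteSpace C₁] {d₂ : C₂ →ₗ[ℂ] C₁}
    {d₁ : C₁ →L[ℂ] C₀} {d₀ : C₀ →L[ℂ] Z} (h₁₂ : ∀ x, d₁ (d₂ x) = 0) (h₀₁ : ∀ x, d₀ (d₁ x) = 0)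
    (hex : StrictExact d₂ (d₁ : C₁ →ₗ[ℂ] C₀)) (Θ₁ : C₁ →L[ℂ] C₁) (Θ₀ : C₀ →L[ℂ] C₀)
    (hΘ : ∀ x, Θ₀ (d₁ x) = d₁ (Θ₁ x)) {κ : ℝ} (hκ : ∀ x, ‖d₀ (Θ₀ x)‖ ≤ κ * ‖d₀ x‖)
    (hK : ∀ μ : ℂ, ∃ c > 0, ∀ a b, ∃ b',
      ‖b + d₁ b'‖ ≤ c * (‖d₁ a + (Θ₀ b - μ • b)‖ + ‖d₀ b‖)) :
    StrictExact (d₁ : C₁ →ₗ[ℂ] C₀) (d₀ : C₀ →ₗ[ℂ] Z) := by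
  have hcl := hex.isClosed_range h₁₂
  let R : Submodule ℂ C₀ := LinearMap.range (d₁ : C₁ →ₗ[ℂ] C₀)
  have : IsClosed (R : Set C₀) := hcl
  -- Strict exactness at `C₁` makes `R` closed, so the quotient is a Banach space; strict exactness
  -- at `C₀` amounts to `d₀` being bounded below on it. The estimates `hK` rule out approximate
  -- eigenvalues of the operator induced by `Θ₀` on approximate kernels of `d₀`.
  let T : (C₀ ⧸ R) →L[ℂ] (C₀ ⧸ R) := R.liftQL (R.mkQL ∘L Θ₀) (by
    rintro _ ⟨x, rfl⟩
    simp only [LinearMap.mem_ker, ContinuousLinearMap.coe_coe, ContinuousLinearMap.comp_apply,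
      Submodule.mkQL_apply, Submodule.mkQ_apply, Submodule.Quotient.mk_eq_zero, hΘ]
    exact ⟨_, rfl⟩)
  let S : (C₀ ⧸ R) →L[ℂ] Z := R.liftQL d₀ (by
    rintro _ ⟨x, rfl⟩
    exact h₀₁ x)
  have hT : ∀ x, T (Submodule.Quotient.mk x) = Submodule.Quotient.mk (Θ₀ x) := fun x => rfl
  have hS : ∀ x, S (Submodule.Quotient.mk x) = d₀ x := fun x => rfl
  obtain ⟨c, hc, hb⟩ := bounded_below_of_forall_sub_smul T S (κ := κ)
    (fun q => by
      obtain ⟨x, rfl⟩ := Submodule.Quotient.mk_surjective R q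
      exact hκ x)
    (fun μ => by
      obtain ⟨c, hc, hK⟩ := hK μ
      refine ⟨c, hc, fun q => ?_⟩
      obtain ⟨b, rfl⟩ := Submodule.Quotient.mk_surjective R q
      refine le_of_forall_pos_le_add fun ε hε => ?_
      have hη : 0 < ε / c := by positivity
      obtain ⟨z, hz, hn⟩ := Submodule.Quotient.norm_mk_lt
        (T (Submodule.Quotient.mk b) - μ • Submodule.Quotient.mk b) hη
      obtain ⟨a, ha⟩ : z - (Θ₀ b - μ • b) ∈ R := (Submodule.Quotient.eq R).1 hz
      obtain ⟨b', hb'⟩ := hK a b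
      have e1 : d₁ a + (Θ₀ b - μ • b) = z := by
        rw [show d₁ a = z - (Θ₀ b - μ • b) from ha]
        abel
      rw [e1] at hb'
      have e2 : (Submodule.Quotient.mk b : C₀ ⧸ R) = Submodule.Quotient.mk (b + d₁ b') := by
        rw [Submodule.Quotient.eq, sub_add_cancel_left]
        exact R.neg_mem ⟨b', rfl⟩
      calc ‖(Submodule.Quotient.mk b : C₀ ⧸ R)‖ ≤ ‖b + d₁ b'‖ := by
            rw [e2]; exact Submodule.Quotient.norm_mk_le R _
        _ ≤ c * (‖z‖ + ‖d₀ b‖) := hb'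
        _ ≤ c * ((‖T (Submodule.Quotient.mk b) - μ • Submodule.Quotient.mk b‖ + ε / c) +
            ‖d₀ b‖) := by gcongr
        _ = _ := by
          rw [hS]
          field_simp
          ring)
  obtain ⟨r, hr, hR⟩ := exists_preimage_norm_le_of_isClosed_range d₁ hcl
  refine ⟨max (2 * c) (r * 2), by positivity, fun y => ?_⟩
  -- A nearly minimal representative of the class of `y`. The second bound, needed to control `‖d₁
  -- x‖` by `‖y‖`, forces the case distinction.
  have hy : ∃ x, ‖y - d₁ x‖ ≤ 2 * c * ‖d₀ y‖ ∧ ‖y - d₁ x‖ ≤ ‖y‖ := by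
    by_cases h0 : d₀ y = 0
    · have h1 := hb (Submodule.Quotient.mk y)
      rw [hS, h0, norm_zero, mul_zero, norm_le_zero_iff, Submodule.Quotient.mk_eq_zero] at h1
      obtain ⟨x, hx⟩ := h1
      have hx' : y - d₁ x = 0 := sub_eq_zero.2 hx.symm
      exact ⟨x, by rw [hx', norm_zero]; positivity, by rw [hx', norm_zero]; positivity⟩
    · by_cases hle : ‖y‖ ≤ 2 * c * ‖d₀ y‖
      · exact ⟨0, by simpa using hle, by simp⟩
      · have hp : 0 < ‖d₀ y‖ := norm_pos_iff.2 h0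
        obtain ⟨z, hz, hn⟩ := Submodule.Quotient.norm_mk_lt
          (Submodule.Quotient.mk y : C₀ ⧸ R) (ε := c * ‖d₀ y‖) (by positivity)
        obtain ⟨x, hx⟩ : y - z ∈ R := (Submodule.Quotient.eq R).1 hz.symm
        have hx' : y - d₁ x = z := by
          rw [show d₁ x = y - z from hx, sub_sub_cancel]
        have h2 := hb (Submodule.Quotient.mk y)
        rw [hS] at h2
        refine ⟨x, ?_, ?_⟩ <;> rw [hx'] <;> linarith
  obtain ⟨x, hx1, hx2⟩ := hy
  obtain ⟨x', hx', hn⟩ := hR x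
  refine ⟨x', ?_, ?_⟩
  · have h3 : ‖d₁ x‖ ≤ 2 * ‖y‖ := by
      have := norm_sub_le y (y - d₁ x)
      rw [sub_sub_cancel] at this
      linarith
    calc ‖x'‖ ≤ r * ‖d₁ x‖ := hn
      _ ≤ r * (2 * ‖y‖) := by gcongr
      _ = r * 2 * ‖y‖ := by ring
      _ ≤ _ := by gcongr; exact le_max_right _ _
  · simp only [ContinuousLinearMap.coe_coe, hx']
    exact hx1.trans (by gcongr; exact le_max_left _ _)

/-- The mapping cone of an endomorphism of a strictly exact complex is strictly exact. -/
theorem StrictExact.cone {d₂ : C₂ →ₗ[ℂ] C₁} {d₁ : C₁ →ₗ[ℂ] C₀} {d₀ : C₀ →ₗ[ℂ] Z}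
    (h₁ : StrictExact d₂ d₁) (h₀ : StrictExact d₁ d₀) (Θ₁ : C₁ →L[ℂ] C₁) (Θ₀ : C₀ →L[ℂ] C₀)
    (hΘ : ∀ x, Θ₀ (d₁ x) = d₁ (Θ₁ x)) :
    ∃ c > 0, ∀ a b, ∃ a' b', ‖a'‖ ≤ c * (‖a‖ + ‖b‖) ∧ ‖b'‖ ≤ c * (‖a‖ + ‖b‖) ∧
      ‖a - (d₂ a' + Θ₁ b')‖ ≤ c * (‖d₁ a + Θ₀ b‖ + ‖d₀ b‖) ∧
      ‖b + d₁ b'‖ ≤ c * (‖d₁ a + Θ₀ b‖ + ‖d₀ b‖) := by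
  obtain ⟨c₁, hc₁, h₁⟩ := h₁
  obtain ⟨c₀, hc₀, h₀⟩ := h₀
  refine ⟨c₀ + c₁ * (1 + ‖Θ₁‖ * c₀) + c₁ * (1 + ‖Θ₀‖ * c₀), by positivity, fun a b => ?_⟩
  -- Take `b₁` with `d₁ b₁` close to `b`. Then `a + Θ₁ b₁` is almost a cycle by `e0`, and is
  -- corrected by `a'`.
  obtain ⟨b₁, hb1, hb2⟩ := h₀ b
  obtain ⟨a', ha1, ha2⟩ := h₁ (a + Θ₁ b₁)
  have e0 : d₁ (a + Θ₁ b₁) = (d₁ a + Θ₀ b) - Θ₀ (b - d₁ b₁) := by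
    rw [map_add, map_sub, hΘ]
    abel
  have e1 : ‖Θ₁ b₁‖ ≤ ‖Θ₁‖ * (c₀ * ‖b‖) := Θ₁.le_opNorm_of_le hb1
  have e2 : ‖Θ₀ (b - d₁ b₁)‖ ≤ ‖Θ₀‖ * (c₀ * ‖d₀ b‖) := Θ₀.le_opNorm_of_le hb2
  have e3 := norm_add_le a (Θ₁ b₁)
  have e4 := norm_sub_le (d₁ a + Θ₀ b) (Θ₀ (b - d₁ b₁))
  rw [← e0] at e4
  have na := norm_nonneg a
  have nb := norm_nonneg b
  have nd := norm_nonneg (d₁ a + Θ₀ b)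
  have nz := norm_nonneg (d₀ b)
  refine ⟨a', -b₁, ?_, ?_, ?_, ?_⟩
  · calc ‖a'‖ ≤ c₁ * (‖a‖ + ‖Θ₁‖ * (c₀ * ‖b‖)) := ha1.trans (by gcongr; linarith)
      _ ≤ c₁ * (1 + ‖Θ₁‖ * c₀) * (‖a‖ + ‖b‖) := by
        have : 0 ≤ c₁ * (‖b‖ + ‖Θ₁‖ * c₀ * ‖a‖) := by positivity
        linarith
      _ ≤ _ := by
        gcongr
        have : 0 ≤ c₁ * (1 + ‖Θ₀‖ * c₀) := by positivity
        linarith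
  · rw [norm_neg]
    calc ‖b₁‖ ≤ c₀ * ‖b‖ := hb1
      _ ≤ c₀ * (‖a‖ + ‖b‖) := by gcongr; linarith
      _ ≤ _ := by
        gcongr
        have : 0 ≤ c₁ * (1 + ‖Θ₀‖ * c₀) := by positivity
        have : 0 ≤ c₁ * (1 + ‖Θ₁‖ * c₀) := by positivity
        linarith
  · have : a - (d₂ a' + Θ₁ (-b₁)) = a + Θ₁ b₁ - d₂ a' := by
      rw [map_neg]
      abel
    rw [this]
    calc ‖a + Θ₁ b₁ - d₂ a'‖ ≤ c₁ * (‖d₁ a + Θ₀ b‖ + ‖Θ₀‖ * (c₀ * ‖d₀ b‖)) :=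
          ha2.trans (by gcongr; linarith)
      _ ≤ c₁ * (1 + ‖Θ₀‖ * c₀) * (‖d₁ a + Θ₀ b‖ + ‖d₀ b‖) := by
        have : 0 ≤ c₁ * (‖d₀ b‖ + ‖Θ₀‖ * c₀ * ‖d₁ a + Θ₀ b‖) := by positivity
        linarith
      _ ≤ _ := by
        gcongr
        have : 0 ≤ c₁ * (1 + ‖Θ₁‖ * c₀) := by positivity
        linarith
  · rw [map_neg, ← sub_eq_add_neg]
    calc ‖b - d₁ b₁‖ ≤ c₀ * ‖d₀ b‖ := hb2
      _ ≤ c₀ * (‖d₁ a + Θ₀ b‖ + ‖d₀ b‖) := by gcongr; linarith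
      _ ≤ _ := by
        gcongr
        have : 0 ≤ c₁ * (1 + ‖Θ₀‖ * c₀) := by positivity
        have : 0 ≤ c₁ * (1 + ‖Θ₁‖ * c₀) := by positivity
        linarith

theorem exp_smul_mul_exp_neg_smul [CompleteSpace Y] (R : Y →L[ℂ] Y) (t : ℂ) :
    NormedSpace.exp (t • R) * NormedSpace.exp ((-t) • R) = 1 := by
  let _ : NormedAlgebra ℚ (Y →L[ℂ] Y) := NormedAlgebra.restrictScalars ℚ ℂ _
  rw [neg_smul, ← NormedSpace.exp_add_of_commute (Commute.neg_right (Commute.refl _)),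
    add_neg_cancel, NormedSpace.exp_zero]

/-- If `J` intertwines `A` with the commutator of `P` and `R`, then it intertwines the one
parameter groups. -/
theorem exp_intertwine [CompleteSpace V] [CompleteSpace X] [CompleteSpace Y]
    (J : V →L[ℂ] X →L[ℂ] Y) (A : V →L[ℂ] V) (P : X →L[ℂ] X) (R : Y →L[ℂ] Y)
    (h : ∀ v x, R (J v x) = J v (P x) + J (A v) x) (t : ℂ) (v : V) (x : X) :
    NormedSpace.exp (t • R) (J v x) =
      J (NormedSpace.exp (t • A) v) (NormedSpace.exp (t • P) x) := by
  -- `G` solves `G' = R G`, so `exp (-s R) (G s)` has zero derivative and keeps its value `J v x` at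
  -- `0`.
  let G : ℂ → Y := fun s => J (NormedSpace.exp (s • A) v) (NormedSpace.exp (s • P) x)
  have hG : ∀ s, HasDerivAt G (R (G s)) s := by
    intro s
    have h1 : HasDerivAt (fun s : ℂ => NormedSpace.exp (s • A) v)
        (A (NormedSpace.exp (s • A) v)) s := by
      simpa using (hasDerivAt_exp_smul_const' A s).clm_apply (hasDerivAt_const s v)
    have h2 : HasDerivAt (fun s : ℂ => NormedSpace.exp (s • P) x)
        (P (NormedSpace.exp (s • P) x)) s := by
      simpa using (hasDerivAt_exp_smul_const' P s).clm_apply (hasDerivAt_const s x)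
    have h3 : HasDerivAt (fun s : ℂ => J (NormedSpace.exp (s • A) v))
        (J (A (NormedSpace.exp (s • A) v))) s := by
      simpa using (hasDerivAt_const s J).clm_apply h1
    have h4 := h3.clm_apply h2
    rw [show R (G s) = J (A (NormedSpace.exp (s • A) v)) (NormedSpace.exp (s • P) x) +
      J (NormedSpace.exp (s • A) v) (P (NormedSpace.exp (s • P) x)) by
        rw [h]; abel]
    exact h4
  let H : ℂ → Y := fun s => NormedSpace.exp (s • -R) (G s)
  have hH : ∀ s, HasDerivAt H 0 s := by
    intro s
    have h1 := (hasDerivAt_exp_smul_const (-R) s).clm_apply (hG s)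
    convert h1 using 1
    simp
  have hconst : H t = H 0 :=
    is_const_of_deriv_eq_zero (fun s => (hH s).differentiableAt) (fun s => (hH s).deriv) t 0
  have hinv : NormedSpace.exp (t • R) * NormedSpace.exp (t • -R) = 1 := by
    rw [smul_neg, ← neg_smul, exp_smul_mul_exp_neg_smul]
  have h0 : H 0 = J v x := by simp [H, G]
  rw [← h0, ← hconst]
  change (NormedSpace.exp (t • R) * NormedSpace.exp (t • -R)) (G t) = G t
  rw [hinv]
  rfl

end Spectral

/-! ### A Banach space norm on the tensor product with a finite dimensional space. -/

section TensorNorm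

variable {E : Type*} [NormedAddCommGroup E] [NormedSpace ℂ E]
variable {M N W : Type*} [AddCommMonoid M] [Module ℂ M] [Module.Finite ℂ M] [Module.Free ℂ M]
  [AddCommMonoid N] [Module ℂ N] [Module.Finite ℂ N] [Module.Free ℂ N] [NormedAddCommGroup W] [NormedSpace ℂ W]

/-- The identification of `E ⊗ M` with a finite power of `E`. -/
def tensorCoord (E M : Type*) [NormedAddCommGroup E] [NormedSpace ℂ E] [AddCommMonoid M]
    [Module ℂ M] [Module.Finite ℂ M] [Module.Free ℂ M] :
    E ⊗[ℂ] M ≃ₗ[ℂ] (Fin (Module.finrank ℂ M) → E) :=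
  (TensorProduct.equivFinsuppOfBasisRight (Module.finBasis ℂ M)).trans
    (Finsupp.linearEquivFunOnFinite ℂ E _)

theorem tensorCoord_tmul (e : E) (m : M) (i : Fin (Module.finrank ℂ M)) :
    tensorCoord E M (e ⊗ₜ m) i = (Module.finBasis ℂ M).repr m i • e := by
  simp [tensorCoord]

theorem tensorCoord_eq_rid (t : E ⊗[ℂ] M) (i : Fin (Module.finrank ℂ M)) :
    tensorCoord E M t i =
      TensorProduct.rid ℂ E (LinearMap.lTensor E ((Module.finBasis ℂ M).coord i) t) := by
  induction t using TensorProduct.induction_on with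
  | zero => simp
  | tmul e m => simp [tensorCoord_tmul]
  | add x y hx hy => simp only [map_add, Pi.add_apply, hx, hy]

/-- The supremum norm in the coordinates of a chosen basis; only the topology, which is independent
of the choice, enters the theorem. -/
instance tensorNormedAddCommGroup : NormedAddCommGroup (E ⊗[ℂ] M) :=
  NormedAddCommGroup.induced _ _ (tensorCoord E M) (tensorCoord E M).injective

instance tensorNormedSpace : NormedSpace ℂ (E ⊗[ℂ] M) :=
  NormedSpace.induced ℂ _ _ (tensorCoord E M)

/-- `tensorCoord` as an isometry. -/
def tensorIso (E M : Type*) [NormedAddCommGroup E] [NormedSpace ℂ E] [AddCommMonoid M]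
    [Module ℂ M] [Module.Finite ℂ M] [Module.Free ℂ M] :
    E ⊗[ℂ] M ≃ₗᵢ[ℂ] (Fin (Module.finrank ℂ M) → E) :=
  ⟨tensorCoord E M, fun _ => rfl⟩

theorem tensorIso_apply (t : E ⊗[ℂ] M) : tensorIso E M t = tensorCoord E M t := rfl

instance tensorCompleteSpace [CompleteSpace E] : CompleteSpace (E ⊗[ℂ] M) :=
  (tensorIso E M).toIsometryEquiv.completeSpace

theorem tensor_sum_coord (t : E ⊗[ℂ] M) :
    ∑ i, tensorCoord E M t i ⊗ₜ[ℂ] Module.finBasis ℂ M i = t := by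
  induction t using TensorProduct.induction_on with
  | zero => simp
  | tmul e m =>
    simp only [tensorCoord_tmul, TensorProduct.smul_tmul, ← TensorProduct.tmul_sum,
      (Module.finBasis ℂ M).sum_repr]
  | add x y hx hy =>
    conv_rhs => rw [← hx, ← hy]
    simp only [map_add, Pi.add_apply, TensorProduct.add_tmul, Finset.sum_add_distrib]

theorem continuous_of_tmul {g : E ⊗[ℂ] M →ₗ[ℂ] W}
    (h : ∀ m, Continuous fun e => g (e ⊗ₜ m)) : Continuous g := by
  have : (g : E ⊗[ℂ] M → W) = fun t =>
      ∑ i, g (tensorIso E M t i ⊗ₜ[ℂ] Module.finBasis ℂ M i) := by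
    funext t
    simp only [tensorIso_apply]
    rw [← map_sum, tensor_sum_coord]
  rw [this]
  refine continuous_finsetSum _ fun i _ => (h _).comp ?_
  exact (continuous_apply i).comp (tensorIso E M).continuous

theorem continuous_tmul_left (m : M) : Continuous fun e : E => e ⊗ₜ[ℂ] m := by
  rw [← (tensorIso E M).comp_continuous_iff]
  refine continuous_pi fun i => ?_
  simp only [Function.comp_apply, tensorIso_apply, tensorCoord_tmul]
  exact continuous_const_smul _

theorem continuous_lTensor (h : M →ₗ[ℂ] N) : Continuous (LinearMap.lTensor E h) :=
  continuous_of_tmul fun m => by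
    simpa using continuous_tmul_left (h m)

theorem continuous_rTensor (R : E →L[ℂ] E) :
    Continuous (LinearMap.rTensor M (R : E →ₗ[ℂ] E)) :=
  continuous_of_tmul fun m => by
    simp only [LinearMap.rTensor_tmul]
    exact (continuous_tmul_left m).comp R.continuous

end TensorNorm

/-! ### Chains as Banach spaces and the boundary as a bounded operator. -/

section Chains

variable {L : Type*} [LieRing L] [LieAlgebra ℂ L] [FiniteDimensional ℂ L]
variable {A : Type*} [LieRing A] [LieAlgebra ℂ A] [FiniteDimensional ℂ A]
variable {E : Type*} [NormedAddCommGroup E] [NormedSpace ℂ E]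

/-- The coordinates defining the norm are among the maps `id ⊗ φ`, and each of those maps is
continuous for the norm. -/
theorem chainTopology_eq (p : ℕ) :
    chainTopology L E p = (inferInstance : TopologicalSpace (Chain L E p)) := by
  refine le_antisymm ?_ ?_
  · have h1 : (inferInstance : TopologicalSpace (Chain L E p)) =
        TopologicalSpace.induced (tensorIso E (⋀[ℂ]^p L)) inferInstance :=
      (tensorIso E (⋀[ℂ]^p L)).isometry.isUniformInducing.isInducing.eq_induced
    rw [h1, ← continuous_iff_le_induced]
    refine @continuous_pi _ _ _ (chainTopology L E p) _ _ fun i => ?_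
    simp only [tensorIso_apply, tensorCoord_eq_rid]
    exact continuous_iff_le_induced.2 (iInf_le _ _)
  · refine le_iInf fun φ => ?_
    rw [← continuous_iff_le_induced]
    change Continuous ((TensorProduct.rid ℂ E).toLinearMap ∘ₗ LinearMap.lTensor E φ)
    refine continuous_of_tmul fun m => ?_
    simp only [LinearMap.comp_apply, LinearMap.lTensor_tmul, LinearEquiv.coe_coe,
      TensorProduct.rid_tmul]
    exact continuous_const_smul _

theorem isClosed_chainTopology {p : ℕ} {S : Set (Chain L E p)} :
    IsClosed[chainTopology L E p] S ↔ IsClosed S := by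
  rw [chainTopology_eq]

/-- `cwedge` as a bounded operator. -/
def cwedgeL (E : Type*) [NormedAddCommGroup E] [NormedSpace ℂ E] (p : ℕ) (x : L) :
    Chain L E p →L[ℂ] Chain L E (p + 1) :=
  ⟨cwedge E p x, continuous_lTensor _⟩

@[simp] theorem cwedgeL_apply (p : ℕ) (x : L) (b : Chain L E p) :
    cwedgeL E p x b = cwedge E p x b := rfl

/-- `ccontr` as a bounded operator, linear in the functional. -/
def ccontrL (E : Type*) [NormedAddCommGroup E] [NormedSpace ℂ E] (p : ℕ) :
    Module.Dual ℂ L →ₗ[ℂ] (Chain L E (p + 1) →L[ℂ] Chain L E p) where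
  toFun φ := ⟨ccontr E p φ, continuous_lTensor _⟩
  map_add' φ ψ := by
    ext1 b
    exact LinearMap.congr_fun (ccontr_add p φ ψ) b
  map_smul' c φ := by
    ext1 b
    exact LinearMap.congr_fun (ccontr_smul p c φ) b

@[simp] theorem ccontrL_apply (p : ℕ) (φ : Module.Dual ℂ L) (b : Chain L E (p + 1)) :
    ccontrL E p φ b = ccontr E p φ b := rfl

/-- `lieOp` as a bounded operator. -/
def lieOpL (R : E →L[ℂ] E) (δ : L →ₗ[ℂ] L) (p : ℕ) : Chain L E p →L[ℂ] Chain L E p :=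
  ⟨lieOp R δ p, (continuous_rTensor R).sub (continuous_lTensor _)⟩

@[simp] theorem lieOpL_apply (R : E →L[ℂ] E) (δ : L →ₗ[ℂ] L) (p : ℕ) (b : Chain L E p) :
    lieOpL R δ p b = lieOp R δ p b := rfl

/-- `cmap` as a bounded operator. -/
def cmapL (E : Type*) [NormedAddCommGroup E] [NormedSpace ℂ E] (g : A →ₗ[ℂ] L) (p : ℕ) :
    Chain A E p →L[ℂ] Chain L E p :=
  ⟨cmap E g p, continuous_lTensor _⟩

@[simp] theorem cmapL_apply (g : A →ₗ[ℂ] L) (p : ℕ) (b : Chain A E p) :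
    cmapL E g p b = cmap E g p b := rfl

/-- Decomposable elements `x ∧ b` span the positive exterior powers, and on them Cartan's formula
expresses the boundary through bounded operators and the boundary one degree lower. -/
theorem continuous_bd (ρ : L →ₗ[ℂ] E →L[ℂ] E) (f : Module.Dual ℂ L) (p : ℕ) :
    Continuous (bd ρ f p) := by
  have key : ∀ p : ℕ,
      (∀ (b : ⋀[ℂ]^p L) (x : L), Continuous fun e : E => bd ρ f p (e ⊗ₜ wedge p x b)) →
      Continuous (bd ρ f p) := by
    intro p h
    refine continuous_of_tmul fun m => ?_
    have hm : m ∈ Submodule.span ℂ (Set.range (exteriorPower.ιMulti ℂ (p + 1) (M := L))) := by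
      rw [exteriorPower.ιMulti_span]
      trivial
    induction hm using Submodule.span_induction with
    | mem x hx =>
      obtain ⟨v, rfl⟩ := hx
      rw [ιMulti_succ]
      exact h _ _
    | zero => simpa using continuous_const
    | add x y _ _ hx hy =>
      simp only [TensorProduct.tmul_add, map_add]
      exact hx.add hy
    | smul c x _ hx =>
      simp only [TensorProduct.tmul_smul, map_smul]
      exact hx.const_smul c
  induction p with
  | zero =>
    refine key 0 fun b x => ?_
    simp only [← cwedge_tmul, bd_cwedge_zero]
    have := continuous_tmul_left (E := E) b
    exact ((lieOpL (ρ x) (adL x) 0).continuous.comp this).sub (this.const_smul (f x))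
  | succ p ih =>
    refine key (p + 1) fun b x => ?_
    simp only [← cwedge_tmul, bd_cwedge]
    have := continuous_tmul_left (E := E) b
    exact (((lieOpL (ρ x) (adL x) (p + 1)).continuous.comp this).sub (this.const_smul (f x))).sub
      ((cwedgeL E p x).continuous.comp (ih.comp this))

/-- The boundary as a bounded operator. -/
def bdL (ρ : L →ₗ[ℂ] E →L[ℂ] E) (f : Module.Dual ℂ L) (p : ℕ) :
    Chain L E (p + 1) →L[ℂ] Chain L E p :=
  ⟨bd ρ f p, continuous_bd ρ f p⟩

@[simp] theorem bdL_apply (ρ : L →ₗ[ℂ] E →L[ℂ] E) (f : Module.Dual ℂ L) (p : ℕ)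
    (b : Chain L E (p + 1)) : bdL ρ f p b = bd ρ f p b := rfl

/-- The differential as a bounded operator. -/
def diffL (ρ : L →ₗ[ℂ] E →L[ℂ] E) (f : Module.Dual ℂ L) :
    (p : ℕ) → Chain L E p →L[ℂ] Chain L E (p - 1)
  | 0 => 0
  | p + 1 => bdL ρ f p

theorem coe_diffL (ρ : L →ₗ[ℂ] E →L[ℂ] E) (f : Module.Dual ℂ L) (p : ℕ) :
    (diffL ρ f p : Chain L E p →ₗ[ℂ] Chain L E (p - 1)) = differential ρ f p := by
  cases p with
  | zero => rfl
  | succ p => rfl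

theorem diffL_apply (ρ : L →ₗ[ℂ] E →L[ℂ] E) (f : Module.Dual ℂ L) (p : ℕ) (b : Chain L E p) :
    diffL ρ f p b = differential ρ f p b := by
  rw [← coe_diffL]
  rfl

theorem subsingleton_chain {p : ℕ} (hp : Module.finrank ℂ L < p) :
    Subsingleton (Chain L E p) := by
  have h0 : Module.finrank ℂ (⋀[ℂ]^p L) = 0 := by
    rw [exteriorPower.finrank_eq, Nat.choose_eq_zero_of_lt hp]
  have : Subsingleton (⋀[ℂ]^p L) := Module.finrank_zero_iff.1 h0
  exact ⟨fun a b => (tensorCoord E (⋀[ℂ]^p L)).injective (by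
    funext i
    exact absurd i.2 (by omega))⟩

end Chains

/-! ### A norm on the dual of the Lie algebra. -/

section DualNorm

variable {L : Type*} [LieRing L] [LieAlgebra ℂ L] [FiniteDimensional ℂ L]

/-- Evaluation of functionals on a basis. -/
def dualCoord (L : Type*) [LieRing L] [LieAlgebra ℂ L] [FiniteDimensional ℂ L] :
    Module.Dual ℂ L →ₗ[ℂ] (Fin (Module.finrank ℂ L) → ℂ) :=
  LinearMap.pi fun i => LinearMap.applyₗ (Module.finBasis ℂ L i)

theorem dualCoord_injective : Function.Injective (dualCoord L) := fun _ _ h =>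
  (Module.finBasis ℂ L).ext fun i => congrFun h i

instance dualNormedAddCommGroup : NormedAddCommGroup (Module.Dual ℂ L) :=
  NormedAddCommGroup.induced _ _ (dualCoord L) dualCoord_injective

instance dualNormedSpace : NormedSpace ℂ (Module.Dual ℂ L) :=
  NormedSpace.induced ℂ _ _ (dualCoord L)

theorem norm_dual (f : Module.Dual ℂ L) : ‖f‖ = ‖dualCoord L f‖ := rfl

theorem continuous_dual_eval (x : L) : Continuous fun f : Module.Dual ℂ L => f x :=
  LinearMap.continuous_of_finiteDimensional
    (LinearMap.applyₗ x : Module.Dual ℂ L →ₗ[ℂ] ℂ)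

theorem dualTopology_eq :
    dualTopology L = (inferInstance : TopologicalSpace (Module.Dual ℂ L)) := by
  refine le_antisymm ?_ ?_
  · have h1 : (inferInstance : TopologicalSpace (Module.Dual ℂ L)) =
        TopologicalSpace.induced (dualCoord L) inferInstance := rfl
    rw [h1, ← continuous_iff_le_induced]
    refine @continuous_pi _ _ _ (dualTopology L) _ _ fun i => ?_
    have h2 : @Continuous _ _ (dualTopology L) _ fun (f : Module.Dual ℂ L) (x : L) => f x :=
      continuous_induced_dom
    exact @Continuous.comp _ _ _ (dualTopology L) _ _ _ _
      (continuous_apply (Module.finBasis ℂ L i)) h2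
  · rw [← continuous_iff_le_induced]
    exact continuous_pi continuous_dual_eval

theorem isClosed_characters : IsClosed (characters L) := by
  simp only [characters, Set.ofPred_forall]
  exact isClosed_iInter fun x => isClosed_iInter fun y =>
    isClosed_eq (continuous_dual_eval _) continuous_const

end DualNorm

/-! ### The spectra via strict exactness, and their compactness. -/

section Spectrum

variable {L : Type*} [LieRing L] [LieAlgebra ℂ L]
variable {E : Type*} [NormedAddCommGroup E] [NormedSpace ℂ E]

/-- The boundary operators of `f` square to zero. -/
def IsComplex (ρ : L →ₗ[ℂ] E →L[ℂ] E) (f : Module.Dual ℂ L) : Prop :=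
  ∀ p b, bd ρ f p (bd ρ f (p + 1) b) = 0

theorem IsComplex.differential_bd {ρ : L →ₗ[ℂ] E →L[ℂ] E} {f : Module.Dual ℂ L}
    (h : IsComplex ρ f) (p : ℕ) (b : Chain L E (p + 1)) :
    differential ρ f p (bd ρ f p b) = 0 := by
  cases p with
  | zero => rfl
  | succ p => exact h p b

variable [FiniteDimensional ℂ L]

/-- Strict exactness of the chain complex in degree `p`. -/
def StrictExactAt (ρ : L →ₗ[ℂ] E →L[ℂ] E) (f : Module.Dual ℂ L) (p : ℕ) : Prop :=
  StrictExact (bd ρ f p) (differential ρ f p)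

/-- The characters at which the chain complex is not strictly exact in degree `p`. -/
def strictSpectrum (ρ : L →ₗ[ℂ] E →L[ℂ] E) (p : ℕ) : Set (Module.Dual ℂ L) :=
  {f ∈ characters L | ¬ StrictExactAt ρ f p}

theorem isComplex_of_mem_characters {ρ : L →ₗ[ℂ] E →L[ℂ] E} (hρ : IsRightAction ρ)
    {f : Module.Dual ℂ L} (hf : f ∈ characters L) : IsComplex ρ f :=
  fun p b => bd_bd ρ hρ f hf p b

theorem strictExactAt_of_lt (ρ : L →ₗ[ℂ] E →L[ℂ] E) (f : Module.Dual ℂ L) {p : ℕ}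
    (hp : Module.finrank ℂ L < p) : StrictExactAt ρ f p :=
  have := subsingleton_chain (E := E) hp
  StrictExact.of_subsingleton _ _

theorem homotopy_zero (ρ : L →ₗ[ℂ] E →L[ℂ] E) (f : Module.Dual ℂ L) (y : L) (b : Chain L E 0) :
    lieOp (ρ y) (adL y) 0 b - f y • b = bd ρ f 0 (cwedge E 0 y b) :=
  (bd_cwedge_zero ρ f y b).symm

theorem homotopy_succ (ρ : L →ₗ[ℂ] E →L[ℂ] E) (f : Module.Dual ℂ L) (y : L) (p : ℕ)
    (b : Chain L E (p + 1)) :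
    lieOp (ρ y) (adL y) (p + 1) b - f y • b =
      bd ρ f (p + 1) (cwedge E (p + 1) y b) + cwedge E p y (bd ρ f p b) := by
  rw [bd_cwedge, sub_add_cancel]

/-- An operator of the form `d h + h d` commutes with `d` as soon as `d² = 0`. Unlike `lieOp_ad_bd`,
this does not require `f` to be a character. -/
theorem IsComplex.bd_lieOp {ρ : L →ₗ[ℂ] E →L[ℂ] E} {f : Module.Dual ℂ L} (hf : IsComplex ρ f)
    (y : L) (p : ℕ) (b : Chain L E (p + 1)) :
    bd ρ f p (lieOp (ρ y) (adL y) (p + 1) b) = lieOp (ρ y) (adL y) p (bd ρ f p b) := by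
  have h1 := homotopy_succ ρ f y p b
  rw [sub_eq_iff_eq_add] at h1
  rw [h1]
  simp only [map_add, map_smul, hf p, zero_add]
  cases p with
  | zero => rw [← homotopy_zero, sub_add_cancel]
  | succ p =>
    have h2 := homotopy_succ ρ f y p (bd ρ f (p + 1) b)
    rw [hf p, map_zero, add_zero] at h2
    rw [← h2, sub_add_cancel]

theorem continuous_bdL (ρ : L →ₗ[ℂ] E →L[ℂ] E) (p : ℕ) : Continuous fun f => bdL ρ f p := by
  have h : (fun f => bdL ρ f p) = fun f => bdL ρ 0 p - ccontrL E p f := by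
    funext f
    ext1 b
    have := LinearMap.congr_fun (bd_add ρ 0 f p) b
    rw [zero_add] at this
    exact this
  rw [h]
  exact continuous_const.sub (LinearMap.continuous_of_finiteDimensional (ccontrL E p))

theorem continuous_diffL (ρ : L →ₗ[ℂ] E →L[ℂ] E) (p : ℕ) : Continuous fun f => diffL ρ f p := by
  cases p with
  | zero => exact continuous_const
  | succ p => exact continuous_bdL ρ p

variable [CompleteSpace E]

/-- For `p > k` the range of the differential in degree `p` is the kernel in degree `p - 1`, hence
closed, so the closedness condition matters only at `k`. Degrees above `dim L` carry no chains. -/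
theorem sigmaPi_eq (ρ : L →ₗ[ℂ] E →L[ℂ] E) (hρ : IsRightAction ρ) (k : ℕ) :
    sigmaPi ρ k = ⋃ p ∈ Set.Ici k, strictSpectrum ρ p := by
  ext f
  simp only [sigmaPi, homologySpectrum, strictSpectrum, Set.mem_union, Set.mem_iUnion,
    Set.mem_ofPred_eq, exists_prop]
  constructor
  · rintro (⟨p, hp, hf, h⟩ | ⟨hf, h⟩)
    · refine ⟨p, hp.1, hf, fun hs => h ?_⟩
      exact hs.range_eq_ker ((isComplex_of_mem_characters hρ hf).differential_bd p)
    · refine ⟨k, Set.self_mem_Ici, hf, fun hs => h ?_⟩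
      rw [StrictExactAt, ← coe_diffL] at hs
      rw [← coe_diffL]
      refine isClosed_chainTopology.2 (hs.isClosed_range fun x => ?_)
      rw [diffL_apply]
      exact (isComplex_of_mem_characters hρ hf).differential_bd k x
  · rintro ⟨p, hp, hf, h⟩
    by_contra hcon
    push Not at hcon
    obtain ⟨h1, h2⟩ := hcon
    have hpn : p ≤ Module.finrank ℂ L := by
      by_contra hlt
      exact h (strictExactAt_of_lt ρ f (not_le.1 hlt))
    have hex : ∀ q, k ≤ q → q ≤ Module.finrank ℂ L →
        LinearMap.range (bd ρ f q) = LinearMap.ker (differential ρ f q) :=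
      fun q hq hqn => h1 q ⟨hq, hqn⟩ hf
    have hcl : IsClosed (LinearMap.range (differential ρ f p) : Set (Chain L E (p - 1))) := by
      rcases (Set.mem_Ici.1 hp).eq_or_lt with rfl | hlt
      · exact isClosed_chainTopology.1 (h2 hf)
      · obtain ⟨q, rfl⟩ : ∃ q, p = q + 1 := ⟨p - 1, by omega⟩
        change IsClosed (LinearMap.range (bd ρ f q) : Set (Chain L E q))
        rw [hex q (by omega) (by omega), ← coe_diffL]
        exact (diffL ρ f q).isClosed_ker
    refine h ?_
    rw [← coe_diffL] at hcl
    rw [StrictExactAt, ← coe_diffL]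
    refine strictExact_of_range_eq_ker (A := bdL ρ f p) ?_ hcl
    rw [coe_diffL]
    exact hex p hp hpn

/-- Exterior multiplication by `y` is a homotopy from the Lie derivative along `y` to the scalar `f
y`, so strict exactness can fail only while `|f y|` is bounded by norms that do not depend on `f`.
Only `IsComplex` is assumed, so that the bound applies directly to translates of a character under a
flow. -/
theorem exists_bound_of_not_strictExactAt (ρ : L →ₗ[ℂ] E →L[ℂ] E) (y : L) (p : ℕ) :
    ∃ C : ℝ, ∀ f, IsComplex ρ f → ¬ StrictExactAt ρ f p → ‖f y‖ ≤ C := by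
  refine ⟨max (‖lieOpL (ρ y) (adL y) (p + 1)‖ * ‖(1 : Chain L E (p + 1) →L[ℂ] Chain L E (p + 1))‖)
    (‖lieOpL (ρ y) (adL y) p‖ * ‖(1 : Chain L E p →L[ℂ] Chain L E p)‖), fun f hf h => ?_⟩
  by_contra hlt
  rw [not_le, max_lt_iff] at hlt
  refine h ?_
  cases p with
  | zero =>
    refine StrictExact.of_homotopy (f y) (lieOpL (ρ y) (adL y) 1) (lieOpL (ρ y) (adL y) 0)
      (cwedgeL E 0 y) 0 hlt.1 hlt.2 (hf.bd_lieOp y 0) fun b => ?_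
    simpa using homotopy_zero ρ f y b
  | succ p =>
    refine StrictExact.of_homotopy (f y) (lieOpL (ρ y) (adL y) (p + 2))
      (lieOpL (ρ y) (adL y) (p + 1))
      (cwedgeL E (p + 1) y) (cwedgeL E p y) hlt.1 hlt.2 (hf.bd_lieOp y (p + 1)) fun b => ?_
    exact homotopy_succ ρ f y p b

theorem exists_norm_bound_of_not_strictExactAt (ρ : L →ₗ[ℂ] E →L[ℂ] E) (p : ℕ) :
    ∃ C : ℝ, ∀ f, IsComplex ρ f → ¬ StrictExactAt ρ f p → ‖f‖ ≤ C := by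
  choose C hC using fun i =>
    exists_bound_of_not_strictExactAt ρ (Module.finBasis ℂ L i) p
  refine ⟨∑ i, |C i|, fun f hf h => ?_⟩
  rw [norm_dual]
  refine (pi_norm_le_iff_of_nonneg (by positivity)).2 fun i => ?_
  refine (hC i f hf h).trans ((le_abs_self _).trans ?_)
  exact Finset.single_le_sum (f := fun i => |C i|) (fun i _ => abs_nonneg _) (Finset.mem_univ i)

theorem isCompact_strictSpectrum (ρ : L →ₗ[ℂ] E →L[ℂ] E) (hρ : IsRightAction ρ) (p : ℕ) :
    IsCompact (strictSpectrum ρ p) := by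
  have : ProperSpace (Module.Dual ℂ L) := FiniteDimensional.proper ℂ _
  refine Metric.isCompact_of_isClosed_isBounded ?_ ?_
  · rw [← closure_subset_iff_isClosed]
    intro f hf
    have hfc : f ∈ characters L :=
      closure_minimal (fun g hg => hg.1) isClosed_characters hf
    refine ⟨hfc, fun hs => ?_⟩
    rw [StrictExactAt, ← coe_diffL] at hs
    obtain ⟨ε, hε, H⟩ := StrictExact.perturb (A := bdL ρ f p) hs
    have h1 : ∀ᶠ g in 𝓝 f, ‖bdL ρ g p - bdL ρ f p‖ < ε := by
      have := (continuous_bdL ρ p).tendsto f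
      simpa [dist_eq_norm] using Metric.tendsto_nhds.1 this ε hε
    have h2 : ∀ᶠ g in 𝓝 f, ‖diffL ρ g p - diffL ρ f p‖ < ε := by
      have := (continuous_diffL ρ p).tendsto f
      simpa [dist_eq_norm] using Metric.tendsto_nhds.1 this ε hε
    obtain ⟨g, ⟨hgc, hg⟩, hg1, hg2⟩ := (mem_closure_iff_frequently.1 hf).and_eventually
      (h1.and h2) |>.exists
    refine hg ?_
    rw [StrictExactAt, ← coe_diffL]
    refine H (bdL ρ g p) (diffL ρ g p) (fun x => ?_) hg1 hg2
    rw [diffL_apply]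
    exact (isComplex_of_mem_characters hρ hgc).differential_bd p x
  · obtain ⟨C, hC⟩ := exists_norm_bound_of_not_strictExactAt ρ p
    exact isBounded_iff_forall_norm_le.2
      ⟨C, fun f hf => hC f (isComplex_of_mem_characters hρ hf.1) hf.2⟩

theorem isCompact_sigmaPi (ρ : L →ₗ[ℂ] E →L[ℂ] E) (hρ : IsRightAction ρ) (k : ℕ) :
    IsCompact (sigmaPi ρ k) := by
  have h : sigmaPi ρ k = ⋃ p ∈ Set.Icc k (Module.finrank ℂ L), strictSpectrum ρ p := by
    rw [sigmaPi_eq ρ hρ k]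
    refine subset_antisymm ?_ ?_
    · refine Set.iUnion₂_subset fun p hp f hf => ?_
      refine Set.mem_biUnion (x := p) ⟨hp, ?_⟩ hf
      by_contra hlt
      exact hf.2 (strictExactAt_of_lt ρ f (not_le.1 hlt))
    · exact Set.biUnion_subset_biUnion_left fun p hp => hp.1
  rw [h]
  exact (Set.finite_Icc _ _).isCompact_biUnion fun p _ => isCompact_strictSpectrum ρ hρ p

end Spectrum

/-! ### Invariance of spectral points under implemented derivations. -/

section Orbit

variable {A : Type*} [LieRing A] [LieAlgebra ℂ A] [FiniteDimensional ℂ A]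
variable {E : Type*} [NormedAddCommGroup E] [NormedSpace ℂ E] [CompleteSpace E]

/-- The flow of a derivation acting on functionals. -/
def dualFlow (δ : A →ₗ[ℂ] A) (t : ℂ) : Module.Dual ℂ A →L[ℂ] Module.Dual ℂ A :=
  NormedSpace.exp (t • LinearMap.toContinuousLinearMap δ.dualMap)

/-- The flow of a derivation acting on chains. -/
def chainFlow (R : E →L[ℂ] E) (δ : A →ₗ[ℂ] A) (p : ℕ) (t : ℂ) : Chain A E p →L[ℂ] Chain A E p :=
  NormedSpace.exp (t • lieOpL R δ p)

theorem chainFlow_neg (R : E →L[ℂ] E) (δ : A →ₗ[ℂ] A) (p : ℕ) (t : ℂ) (b : Chain A E p) :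
    chainFlow R δ p t (chainFlow R δ p (-t) b) = b :=
  congrArg (fun T : Chain A E p →L[ℂ] Chain A E p => T b)
    (exp_smul_mul_exp_neg_smul (lieOpL R δ p) t)

theorem chainFlow_neg' (R : E →L[ℂ] E) (δ : A →ₗ[ℂ] A) (p : ℕ) (t : ℂ) (b : Chain A E p) :
    chainFlow R δ p (-t) (chainFlow R δ p t b) = b := by
  have := chainFlow_neg R δ p (-t) b
  rwa [neg_neg] at this

variable (ρ : A →ₗ[ℂ] E →L[ℂ] E) (R : E →L[ℂ] E) (δ : A →ₗ[ℂ] A)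

/-- The flow of a derivation carries the complex of `f` to the complex of the translate of `f`. -/
theorem chainFlow_bd (hδ : ∀ x y, δ ⁅x, y⁆ = ⁅δ x, y⁆ + ⁅x, δ y⁆)
    (hR : ∀ y e, ρ (δ y) e = ρ y (R e) - R (ρ y e)) (f : Module.Dual ℂ A) (p : ℕ) (t : ℂ)
    (b : Chain A E (p + 1)) :
    chainFlow R δ p t (bd ρ f p b) = bd ρ (dualFlow δ t f) p (chainFlow R δ (p + 1) t b) := by
  have hbd : ∀ (g : Module.Dual ℂ A) (b : Chain A E (p + 1)),
      bd ρ g p b = bd ρ 0 p b - ccontr E p g b := by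
    intro g b
    have := LinearMap.congr_fun (bd_add ρ 0 g p) b
    rwa [zero_add] at this
  have h0 : ∀ b, ccontr E p (0 : Module.Dual ℂ A) b = 0 := by
    intro b
    have := LinearMap.congr_fun (ccontr_smul (E := E) p 0 (0 : Module.Dual ℂ A)) b
    simpa using this
  have c0 : ∀ b, lieOp R δ p (bd ρ 0 p b) = bd ρ 0 p (lieOp R δ (p + 1) b) := by
    intro b
    rw [lieOp_bd ρ 0 R δ hδ hR, LinearMap.zero_comp, h0, sub_zero]
  have c1 : ∀ (g : Module.Dual ℂ A) b, lieOp R δ p (ccontr E p g b) =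
      ccontr E p g (lieOp R δ (p + 1) b) + ccontr E p (g ∘ₗ δ) b := by
    intro g b
    have h1 := lieOp_bd ρ g R δ hδ hR p b
    rw [hbd g, hbd g, map_sub, c0] at h1
    have h2 : lieOp R δ p (ccontr E p g b) = bd ρ 0 p (lieOp R δ (p + 1) b) -
        (bd ρ 0 p (lieOp R δ (p + 1) b) - lieOp R δ p (ccontr E p g b)) := by abel
    rw [h2, h1]
    abel
  -- Write the boundary of `f` as the boundary of `0` minus a contraction. The first part commutes
  -- with the flow (parameter space `ℂ`, trivial flow); the second is intertwined with the flow of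
  -- the dual of `δ` on functionals.
  have e0 := exp_intertwine ((ContinuousLinearMap.id ℂ ℂ).smulRight (bdL ρ 0 p)) 0
    (lieOpL R δ (p + 1)) (lieOpL R δ p) (fun v x => by simp [c0]) t 1 b
  have e1 := exp_intertwine (LinearMap.toContinuousLinearMap (ccontrL E p))
    (LinearMap.toContinuousLinearMap δ.dualMap) (lieOpL R δ (p + 1)) (lieOpL R δ p)
    (fun g x => c1 g x) t f b
  simp only [smul_zero, NormedSpace.exp_zero, one_apply_eq_self, ContinuousLinearMap.smulRight_apply,
    ContinuousLinearMap.id_apply, one_smul, bdL_apply] at e0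
  rw [hbd f, hbd (dualFlow δ t f), map_sub]
  exact congrArg₂ (· - ·) e0 e1

/-- A character in the spectrum is killed by every derivation which is implemented on `E`: its
orbit under the flow of the derivation stays in the spectrum, hence is bounded and constant. -/
theorem comp_eq_zero_of_mem_strictSpectrum (hρ : IsRightAction ρ)
    (hδ : ∀ x y, δ ⁅x, y⁆ = ⁅δ x, y⁆ + ⁅x, δ y⁆)
    (hR : ∀ y e, ρ (δ y) e = ρ y (R e) - R (ρ y e)) {p : ℕ} {f : Module.Dual ℂ A}
    (hf : f ∈ strictSpectrum ρ p) : f ∘ₗ δ = 0 := by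
  have hcomm := fun p t b => chainFlow_bd ρ R δ hδ hR f p t b
  have hcx := isComplex_of_mem_characters hρ hf.1
  have hbd : ∀ q t b, bd ρ (dualFlow δ t f) q b =
      chainFlow R δ q t (bd ρ f q (chainFlow R δ (q + 1) (-t) b)) := by
    intro q t b
    rw [hcomm, chainFlow_neg]
  have hcx' : ∀ t, IsComplex ρ (dualFlow δ t f) := by
    intro t q b
    rw [hbd (q + 1), ← hcomm, hcx, map_zero]
  -- The flow is an isomorphism between the complexes of `f` and of its translate, so strict
  -- exactness of the latter would come back to `f`.
  have hns : ∀ t, ¬ StrictExactAt ρ (dualFlow δ t f) p := by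
    intro t hs
    refine hf.2 ?_
    have hv : ∀ x, chainFlow R δ p (-t) (bd ρ (dualFlow δ t f) p x) =
        bd ρ f p (chainFlow R δ (p + 1) (-t) x) := by
      intro x
      rw [hbd, chainFlow_neg']
    cases p with
    | zero =>
      exact StrictExact.transport hs (chainFlow R δ 1 (-t)) (chainFlow R δ 0 (-t))
        (chainFlow R δ 0 t) (chainFlow_neg' R δ 0 t) hv (c := 0) fun y => by
          change ‖(0 : Chain A E 0)‖ ≤ _
          simp
    | succ p =>
      refine StrictExact.transport hs (chainFlow R δ (p + 2) (-t)) (chainFlow R δ (p + 1) (-t))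
        (chainFlow R δ (p + 1) t) (chainFlow_neg' R δ (p + 1) t) hv
        (c := ‖chainFlow R δ p t‖) fun y => ?_
      change ‖bd ρ (dualFlow δ t f) p (chainFlow R δ (p + 1) t y)‖ ≤ _ * ‖bd ρ f p y‖
      rw [← hcomm]
      exact (chainFlow R δ p t).le_opNorm _
  obtain ⟨C, hC⟩ := exists_norm_bound_of_not_strictExactAt ρ p
  let D : Module.Dual ℂ A →L[ℂ] Module.Dual ℂ A := LinearMap.toContinuousLinearMap δ.dualMap
  have : CompleteSpace (Module.Dual ℂ A) := FiniteDimensional.complete ℂ _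
  have hder : ∀ t : ℂ, HasDerivAt (fun t => dualFlow δ t f) (D (dualFlow δ t f)) t := by
    intro t
    have h := (hasDerivAt_exp_smul_const' D t).clm_apply (hasDerivAt_const t f)
    rw [map_zero, add_zero] at h
    exact h
  -- Liouville's theorem: the orbit is an entire function of `t`, bounded by `C`. Its derivative at
  -- `0` is `f ∘ₗ δ`.
  have hconst : ∀ t, dualFlow δ t f = dualFlow δ 0 f := fun t =>
    Differentiable.apply_eq_apply_of_bounded (fun t => (hder t).differentiableAt)
      (isBounded_iff_forall_norm_le.2 ⟨C, by
        rintro _ ⟨t, rfl⟩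
        exact hC _ (hcx' t) (hns t)⟩) t 0
  have h0 : dualFlow δ 0 f = f := by simp [dualFlow]
  have hd := hder 0
  rw [funext hconst, h0] at hd
  exact hd.unique (hasDerivAt_const 0 f)

end Orbit

/-! ### The complex of an algebra over a codimension one ideal as a mapping cone. -/

section Cone

variable {A L : Type*} [LieRing A] [LieAlgebra ℂ A] [LieRing L] [LieAlgebra ℂ L]
variable {E : Type*} [NormedAddCommGroup E] [NormedSpace ℂ E]

theorem ccontr_cmap (φ : Module.Dual ℂ L) (g : A →ₗ[ℂ] L) (p : ℕ) (b : Chain A E (p + 1)) :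
    ccontr E p φ (cmap E g (p + 1) b) = cmap E g p (ccontr E p (φ ∘ₗ g) b) := by
  suffices H : ccontr E p φ ∘ₗ cmap E g (p + 1) = cmap E g p ∘ₗ ccontr E p (φ ∘ₗ g) from
    LinearMap.congr_fun H b
  clear b
  induction p with
  | zero =>
    refine chain_succ_ext fun x b => ?_
    simp only [LinearMap.comp_apply, cmap_cwedge, ccontr_cwedge_zero, map_smul]
  | succ p ih =>
    refine chain_succ_ext fun x b => ?_
    have ih' := LinearMap.congr_fun ih b
    simp only [LinearMap.comp_apply] at ih'
    simp only [LinearMap.comp_apply, cmap_cwedge, ccontr_cwedge, map_smul, map_sub, ih']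

theorem ccontr_ccontr (φ : Module.Dual ℂ L) (p : ℕ) (b : Chain L E (p + 2)) :
    ccontr E p φ (ccontr E (p + 1) φ b) = 0 := by
  suffices H : ccontr E p φ ∘ₗ ccontr E (p + 1) φ = 0 from LinearMap.congr_fun H b
  clear b
  induction p with
  | zero =>
    refine chain_succ_ext fun x b => ?_
    simp only [LinearMap.comp_apply, ccontr_cwedge, map_smul, map_sub, ccontr_cwedge_zero,
      LinearMap.zero_apply, sub_self]
  | succ p ih =>
    refine chain_succ_ext fun x b => ?_
    have ih' := LinearMap.congr_fun ih b
    simp only [LinearMap.comp_apply, LinearMap.zero_apply] at ih'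
    simp only [LinearMap.comp_apply, ccontr_cwedge, map_smul, map_sub,
      LinearMap.zero_apply, ih', map_zero]
    abel

theorem ccontr_zero (p : ℕ) (b : Chain L E (p + 1)) :
    ccontr E p (0 : Module.Dual ℂ L) b = 0 := by
  have := LinearMap.congr_fun (ccontr_smul (E := E) p 0 (0 : Module.Dual ℂ L)) b
  simpa using this

theorem cwedge_zero (p : ℕ) (b : Chain L E p) : cwedge E p (0 : L) b = 0 := by
  have := cwedge_sub p (0 : L) 0 b
  simpa using this

/-- A splitting `L = A ⊕ ℂ x` of a Lie algebra over an ideal of codimension one. -/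
structure CodimOne (i : A →ₗ⁅ℂ⁆ L) (r : L →ₗ[ℂ] A) (φ : Module.Dual ℂ L) (x : L)
    (δ : A →ₗ[ℂ] A) : Prop where
  retract : ∀ a, r (i a) = a
  retract_vec : r x = 0
  functional : ∀ a, φ (i a) = 0
  functional_vec : φ x = 1
  decomp : ∀ y, i (r y) = y - φ y • x
  bracket : ∀ a, i (δ a) = ⁅x, i a⁆

variable {i : A →ₗ⁅ℂ⁆ L} {r : L →ₗ[ℂ] A} {φ : Module.Dual ℂ L} {x : L} {δ : A →ₗ[ℂ] A}

namespace CodimOne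

theorem cmap_cmap (h : CodimOne i r φ x δ) (p : ℕ) (b : Chain A E p) :
    cmap E r p (cmap E (i : A →ₗ[ℂ] L) p b) = b := by
  rw [LieSpectra.cmap_cmap]
  have : r ∘ₗ (i : A →ₗ[ℂ] L) = LinearMap.id := LinearMap.ext h.retract
  rw [this, cmap_id]

theorem cmap_cmap_succ (h : CodimOne i r φ x δ) (p : ℕ) (b : Chain L E (p + 1)) :
    cmap E (i : A →ₗ[ℂ] L) (p + 1) (cmap E r (p + 1) b) =
      b - cwedge E p x (ccontr E p φ b) := by
  rw [LieSpectra.cmap_cmap]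
  exact cmap_projection _ φ x h.decomp p b

theorem ccontr_cmap (h : CodimOne i r φ x δ) (p : ℕ) (b : Chain A E (p + 1)) :
    ccontr E p φ (cmap E (i : A →ₗ[ℂ] L) (p + 1) b) = 0 := by
  rw [LieSpectra.ccontr_cmap]
  have : φ ∘ₗ (i : A →ₗ[ℂ] L) = 0 := LinearMap.ext h.functional
  rw [this, ccontr_zero, map_zero]

end CodimOne

variable [FiniteDimensional ℂ A] [FiniteDimensional ℂ L]

/-- The mapping cone differential of `Θ - μ`, where `Θ = R ⊗ 1 - 1 ⊗ δ`. -/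
def coneDiff (ρ : A →ₗ[ℂ] E →L[ℂ] E) (g : Module.Dual ℂ A) (R : E →L[ℂ] E) (δ : A →ₗ[ℂ] A)
    (μ : ℂ) (p : ℕ) :
    Chain A E (p + 1) × Chain A E p →ₗ[ℂ] Chain A E p × Chain A E (p - 1) :=
  LinearMap.prod
    (LinearMap.coprod (bd ρ g p) (lieOp R δ p - μ • LinearMap.id))
    (-(differential ρ g p) ∘ₗ LinearMap.snd ℂ _ _)

theorem coneDiff_apply (ρ : A →ₗ[ℂ] E →L[ℂ] E) (g : Module.Dual ℂ A) (R : E →L[ℂ] E)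
    (δ : A →ₗ[ℂ] A) (μ : ℂ) (p : ℕ) (a : Chain A E (p + 1)) (b : Chain A E p) :
    coneDiff ρ g R δ μ p (a, b) =
      (bd ρ g p a + (lieOp R δ p b - μ • b), -differential ρ g p b) := rfl

/-- The projection of chains of `L` onto pairs of chains of `A`. -/
def split (E : Type*) [NormedAddCommGroup E] [NormedSpace ℂ E] (r : L →ₗ[ℂ] A)
    (φ : Module.Dual ℂ L) : (p : ℕ) → Chain L E p →L[ℂ] Chain A E p × Chain A E (p - 1)
  -- In degree `0` the second factor is spurious, since `0 - 1 = 0`, and is filled with zero. Hence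
  -- `split` is inverse to `glue` on both sides only in positive degrees.
  | 0 => (cmapL E r 0).prod 0
  | p + 1 => (cmapL E r (p + 1)).prod (cmapL E r p ∘L ccontrL E p φ)

/-- The chain `a + x ∧ b` of `L`, for a pair `(a, b)` of chains of `A`. -/
def glue (E : Type*) [NormedAddCommGroup E] [NormedSpace ℂ E] (i : A →ₗ⁅ℂ⁆ L) (x : L) :
    (p : ℕ) → Chain A E p × Chain A E (p - 1) →L[ℂ] Chain L E p
  | 0 => (cmapL E (i : A →ₗ[ℂ] L) 0).coprod 0
  | p + 1 => (cmapL E (i : A →ₗ[ℂ] L) (p + 1)).coprod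
      (cwedgeL E p x ∘L cmapL E (i : A →ₗ[ℂ] L) p)

theorem split_zero (b : Chain L E 0) : split E r φ 0 b = (cmap E r 0 b, 0) := rfl

theorem split_succ (p : ℕ) (b : Chain L E (p + 1)) :
    split E r φ (p + 1) b = (cmap E r (p + 1) b, cmap E r p (ccontr E p φ b)) := rfl

theorem glue_zero (a : Chain A E 0) (b : Chain A E 0) :
    glue E i x 0 (a, b) = cmap E (i : A →ₗ[ℂ] L) 0 a := by
  change cmap E (i : A →ₗ[ℂ] L) 0 a + 0 = _
  rw [add_zero]

theorem glue_succ (p : ℕ) (a : Chain A E (p + 1)) (b : Chain A E p) :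
    glue E i x (p + 1) (a, b) = cmap E (i : A →ₗ[ℂ] L) (p + 1) a +
      cwedge E p x (cmap E (i : A →ₗ[ℂ] L) p b) := rfl

namespace CodimOne

theorem glue_split (h : CodimOne i r φ x δ) (p : ℕ) (b : Chain L E p) :
    glue E i x p (split E r φ p b) = b := by
  cases p with
  | zero => rw [split_zero, glue_zero, LieSpectra.cmap_cmap, cmap_degree_zero]
  | succ p =>
    rw [split_succ, glue_succ, h.cmap_cmap_succ]
    cases p with
    | zero => rw [LieSpectra.cmap_cmap, cmap_degree_zero, sub_add_cancel]
    | succ p => rw [h.cmap_cmap_succ, ccontr_ccontr, map_zero, sub_zero, sub_add_cancel]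

theorem split_glue (h : CodimOne i r φ x δ) (p : ℕ) (c : Chain A E (p + 1) × Chain A E p) :
    split E r φ (p + 1) (glue E i x (p + 1) c) = c := by
  obtain ⟨a, b⟩ := c
  rw [glue_succ, split_succ, map_add, map_add, map_add, h.cmap_cmap, cmap_cwedge, h.retract_vec,
    cwedge_zero, add_zero, h.ccontr_cmap, map_zero, zero_add]
  cases p with
  | zero => rw [ccontr_cwedge_zero, h.functional_vec, one_smul, h.cmap_cmap]
  | succ p =>
    rw [ccontr_cwedge, h.functional_vec, one_smul, h.ccontr_cmap, map_zero, sub_zero, h.cmap_cmap]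

/-- The chain complex of `L` is the mapping cone of the action of `x` on the complex of `A`. -/
theorem bd_glue (h : CodimOne i r φ x δ) (ρ : L →ₗ[ℂ] E →L[ℂ] E) (f : Module.Dual ℂ L) (p : ℕ)
    (c : Chain A E (p + 1) × Chain A E p) :
    bd ρ f p (glue E i x (p + 1) c) = glue E i x p
      (coneDiff (ρ ∘ₗ (i : A →ₗ[ℂ] L)) (f ∘ₗ (i : A →ₗ[ℂ] L)) (ρ x) δ (f x) p c) := by
  obtain ⟨a, b⟩ := c
  have hl : ∀ (p : ℕ) (b : Chain A E p), lieOp (ρ x) (adL x) p (cmap E (i : A →ₗ[ℂ] L) p b) =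
      cmap E (i : A →ₗ[ℂ] L) p (lieOp (ρ x) δ p b) := fun p b =>
    (cmap_lieOp _ _ _ _ (fun y => h.bracket y) p b).symm
  rw [coneDiff_apply, glue_succ, map_add, ← cmap_bd]
  cases p with
  | zero => rw [glue_zero, bd_cwedge_zero, hl, map_add, map_sub, map_smul]
  | succ p =>
    change _ = glue E i x (p + 1) (_, -bd (ρ ∘ₗ (i : A →ₗ[ℂ] L)) (f ∘ₗ (i : A →ₗ[ℂ] L)) p b)
    rw [glue_succ, bd_cwedge, hl, ← cmap_bd, map_add, map_sub, map_smul, map_neg, map_neg]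
    abel

theorem split_bd (h : CodimOne i r φ x δ) (ρ : L →ₗ[ℂ] E →L[ℂ] E) (f : Module.Dual ℂ L) (p : ℕ)
    (b : Chain L E (p + 1)) :
    split E r φ p (bd ρ f p b) =
      coneDiff (ρ ∘ₗ (i : A →ₗ[ℂ] L)) (f ∘ₗ (i : A →ₗ[ℂ] L)) (ρ x) δ (f x) p
        (split E r φ (p + 1) b) := by
  conv_lhs => rw [← h.glue_split (p + 1) b, h.bd_glue]
  generalize split E r φ (p + 1) b = c
  cases p with
  | zero =>
    obtain ⟨a, b⟩ := c
    rw [coneDiff_apply, glue_zero, split_zero, h.cmap_cmap]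
    change _ = (_, -(0 : Chain A E 0))
    rw [neg_zero]
  | succ p => rw [h.split_glue]

theorem strictExactAt_succ_iff (h : CodimOne i r φ x δ) (ρ : L →ₗ[ℂ] E →L[ℂ] E)
    (f : Module.Dual ℂ L) (p : ℕ) :
    StrictExactAt ρ f (p + 1) ↔ StrictExact
      (coneDiff (ρ ∘ₗ (i : A →ₗ[ℂ] L)) (f ∘ₗ (i : A →ₗ[ℂ] L)) (ρ x) δ (f x) (p + 1))
      (coneDiff (ρ ∘ₗ (i : A →ₗ[ℂ] L)) (f ∘ₗ (i : A →ₗ[ℂ] L)) (ρ x) δ (f x) p) := by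
  constructor
  · intro hs
    refine StrictExact.transport hs (split E r φ (p + 2)) (split E r φ (p + 1))
      (glue E i x (p + 1)) (h.split_glue p) (fun y => h.split_bd ρ f (p + 1) y)
      (c := ‖glue E i x p‖) fun y => ?_
    change ‖bd ρ f p _‖ ≤ _
    rw [h.bd_glue]
    exact (glue E i x p).le_opNorm _
  · intro hs
    refine StrictExact.transport hs (glue E i x (p + 2)) (glue E i x (p + 1))
      (split E r φ (p + 1)) (h.glue_split (p + 1)) (fun y => (h.bd_glue ρ f (p + 1) y).symm)
      (c := ‖split E r φ p‖) fun y => ?_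
    rw [← h.split_bd]
    exact (split E r φ p).le_opNorm _

end CodimOne

end Cone

/-! ### The projection property. -/

section Projection

universe u v w

variable {A : Type v} {L : Type u} [LieRing A] [LieAlgebra ℂ A] [FiniteDimensional ℂ A]
  [LieRing L] [LieAlgebra ℂ L] [FiniteDimensional ℂ L]
variable {E : Type w} [NormedAddCommGroup E] [NormedSpace ℂ E] [CompleteSpace E]
variable {i : A →ₗ⁅ℂ⁆ L} {r : L →ₗ[ℂ] A} {φ : Module.Dual ℂ L} {x : L} {δ : A →ₗ[ℂ] A}

theorem IsRightAction.comp {ρ : L →ₗ[ℂ] E →L[ℂ] E} (hρ : IsRightAction ρ) (i : A →ₗ⁅ℂ⁆ L) :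
    IsRightAction (ρ ∘ₗ (i : A →ₗ[ℂ] L)) := fun y z e => by
  simpa using hρ (i y) (i z) e

theorem comp_mem_characters {f : Module.Dual ℂ L} (hf : f ∈ characters L) (i : A →ₗ⁅ℂ⁆ L) :
    f ∘ₗ (i : A →ₗ[ℂ] L) ∈ characters A := fun y z => by
  simpa using hf (i y) (i z)

/-- In degree `0` both complexes have the same chains, essentially `E`, and the differential is
zero, so strict exactness is quantitative surjectivity; boundaries from `A` are boundaries for `L`.
This supplies the degree left out by `CodimOne.strictExactAt_succ_iff`. -/
theorem strictExactAt_zero_of_comp (i : A →ₗ⁅ℂ⁆ L) (r : L →ₗ[ℂ] A) (ρ : L →ₗ[ℂ] E →L[ℂ] E)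
    (f : Module.Dual ℂ L)
    (hs : StrictExactAt (ρ ∘ₗ (i : A →ₗ[ℂ] L)) (f ∘ₗ (i : A →ₗ[ℂ] L)) 0) :
    StrictExactAt ρ f 0 := by
  refine StrictExact.transport hs (cmapL E (i : A →ₗ[ℂ] L) 1) (cmapL E (i : A →ₗ[ℂ] L) 0)
    (cmapL E r 0) (fun y => ?_) (fun y => cmap_bd ρ f i 0 y) (c := 0) fun y => ?_
  · rw [cmapL_apply, cmapL_apply, cmap_cmap, cmap_degree_zero]
  · change ‖(0 : Chain A E 0)‖ ≤ _
    simp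

namespace CodimOne

theorem injective (h : CodimOne i r φ x δ) : Function.Injective i :=
  Function.LeftInverse.injective h.retract

theorem derivation (h : CodimOne i r φ x δ) (y z : A) : δ ⁅y, z⁆ = ⁅δ y, z⁆ + ⁅y, δ z⁆ := by
  apply h.injective
  rw [map_add, LieHom.map_lie, LieHom.map_lie, h.bracket, h.bracket, h.bracket, LieHom.map_lie,
    leibniz_lie]

theorem implemented (h : CodimOne i r φ x δ) {ρ : L →ₗ[ℂ] E →L[ℂ] E} (hρ : IsRightAction ρ)
    (y : A) (e : E) : (ρ ∘ₗ (i : A →ₗ[ℂ] L)) (δ y) e =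
      (ρ ∘ₗ (i : A →ₗ[ℂ] L)) y (ρ x e) - ρ x ((ρ ∘ₗ (i : A →ₗ[ℂ] L)) y e) := by
  simp only [LinearMap.comp_apply, LieHom.coe_toLinearMap, h.bracket]
  exact hρ x (i y) e

theorem lieOp_bd (h : CodimOne i r φ x δ) {ρ : L →ₗ[ℂ] E →L[ℂ] E} (hρ : IsRightAction ρ)
    {g : Module.Dual ℂ A} (hg : g ∘ₗ δ = 0) (p : ℕ) (b : Chain A E (p + 1)) :
    lieOp (ρ x) δ p (bd (ρ ∘ₗ (i : A →ₗ[ℂ] L)) g p b) =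
      bd (ρ ∘ₗ (i : A →ₗ[ℂ] L)) g p (lieOp (ρ x) δ (p + 1) b) := by
  rw [LieSpectra.lieOp_bd _ g (ρ x) δ h.derivation (h.implemented hρ), hg, ccontr_zero, sub_zero]

/-- The extension of a functional of `A` with value `μ` at `x`. -/
theorem extension_apply (h : CodimOne i r φ x δ) (g : Module.Dual ℂ A) (μ : ℂ) :
    (g ∘ₗ r + μ • φ) ∘ₗ (i : A →ₗ[ℂ] L) = g ∧ (g ∘ₗ r + μ • φ) x = μ := by
  refine ⟨LinearMap.ext fun a => ?_, ?_⟩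
  · simp [h.retract, h.functional]
  · simp [h.retract_vec, h.functional_vec]

/-- Every bracket in `L` is a combination of a bracket of `A` and of values of `δ`, all killed by
`g`; the value `μ` at `x` is therefore free. -/
theorem extension_mem_characters (h : CodimOne i r φ x δ) {g : Module.Dual ℂ A}
    (hg : g ∈ characters A) (hδ : g ∘ₗ δ = 0) (μ : ℂ) : g ∘ₗ r + μ • φ ∈ characters L := by
  intro y z
  have hδ' : ∀ a, g (δ a) = 0 := fun a => LinearMap.congr_fun hδ a
  have e : ⁅y, z⁆ = i (⁅r y, r z⁆ - φ z • δ (r y) + φ y • δ (r z)) := by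
    have hy : y = i (r y) + φ y • x := by rw [h.decomp]; abel
    have hz : z = i (r z) + φ z • x := by rw [h.decomp]; abel
    conv_lhs => rw [hy, hz]
    simp only [map_add, map_sub, map_smul, h.bracket, LieHom.map_lie, lie_add, add_lie, lie_smul,
      smul_lie, lie_self, smul_zero, add_zero]
    rw [← lie_skew x (i (r y)), smul_neg]
    abel
  have h1 := LinearMap.congr_fun (h.extension_apply g μ).1
    (⁅r y, r z⁆ - φ z • δ (r y) + φ y • δ (r z))
  rw [e]
  refine h1.trans ?_
  rw [map_add, map_sub, map_smul, map_smul, hδ', hδ', hg]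
  simp

theorem strictExactAt_succ (h : CodimOne i r φ x δ) {ρ : L →ₗ[ℂ] E →L[ℂ] E}
    (hρ : IsRightAction ρ) {f : Module.Dual ℂ L} (hf : f ∈ characters L) (p : ℕ)
    (h₁ : StrictExactAt (ρ ∘ₗ (i : A →ₗ[ℂ] L)) (f ∘ₗ (i : A →ₗ[ℂ] L)) (p + 1))
    (h₀ : StrictExactAt (ρ ∘ₗ (i : A →ₗ[ℂ] L)) (f ∘ₗ (i : A →ₗ[ℂ] L)) p) :
    StrictExactAt ρ f (p + 1) := by
  rw [h.strictExactAt_succ_iff]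
  have hδ : (f ∘ₗ (i : A →ₗ[ℂ] L)) ∘ₗ δ = 0 := LinearMap.ext fun a => by
    simpa [h.bracket] using hf x (i a)
  obtain ⟨c, hc, H⟩ := StrictExact.cone h₁ h₀
    (lieOpL (ρ x) δ (p + 1) - f x • ContinuousLinearMap.id ℂ (Chain A E (p + 1)))
    (lieOpL (ρ x) δ p - f x • ContinuousLinearMap.id ℂ (Chain A E p)) (fun b => by
      have := h.lieOp_bd hρ hδ p b
      simp only [sub_apply, smul_apply,
        ContinuousLinearMap.id_apply, lieOpL_apply, map_sub, map_smul]
      exact congrArg (· - _) this)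
  -- The factor `2` passes from the sum of two norms to the maximum norm of the product.
  refine ⟨2 * c, by positivity, fun (y : Chain A E (p + 1) × Chain A E p) => ?_⟩
  obtain ⟨a, b⟩ := y
  obtain ⟨a', b', ha', hb', h1, h2⟩ := H a b
  have hn : ‖a‖ + ‖b‖ ≤ 2 * ‖(a, b)‖ := by
    have := norm_fst_le (a, b)
    have := norm_snd_le (a, b)
    simp only at *
    linarith
  have hn' : ‖bd (ρ ∘ₗ (i : A →ₗ[ℂ] L)) (f ∘ₗ (i : A →ₗ[ℂ] L)) p a +
      (lieOp (ρ x) δ p b - f x • b)‖ +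
      ‖differential (ρ ∘ₗ (i : A →ₗ[ℂ] L)) (f ∘ₗ (i : A →ₗ[ℂ] L)) p b‖ ≤
      2 * ‖coneDiff (ρ ∘ₗ (i : A →ₗ[ℂ] L)) (f ∘ₗ (i : A →ₗ[ℂ] L)) (ρ x) δ (f x) p (a, b)‖ := by
    rw [coneDiff_apply, Prod.norm_mk, norm_neg, two_mul]
    exact add_le_add (le_max_left _ _) (le_max_right _ _)
  have he (z : Chain A E (p + 1) × Chain A E p) (hz : z = coneDiff (ρ ∘ₗ (i : A →ₗ[ℂ] L))
      (f ∘ₗ (i : A →ₗ[ℂ] L)) (ρ x) δ (f x) (p + 1) (a', b')) :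
      ‖(a, b) - z‖ ≤ c * (‖bd (ρ ∘ₗ (i : A →ₗ[ℂ] L)) (f ∘ₗ (i : A →ₗ[ℂ] L)) p a +
      (lieOp (ρ x) δ p b - f x • b)‖ +
      ‖differential (ρ ∘ₗ (i : A →ₗ[ℂ] L)) (f ∘ₗ (i : A →ₗ[ℂ] L)) p b‖) := by
    have hz' : z = (bd (ρ ∘ₗ (i : A →ₗ[ℂ] L)) (f ∘ₗ (i : A →ₗ[ℂ] L)) (p + 1) a' +
        (lieOp (ρ x) δ (p + 1) b' - f x • b'),
        -bd (ρ ∘ₗ (i : A →ₗ[ℂ] L)) (f ∘ₗ (i : A →ₗ[ℂ] L)) p b') := hz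
    rw [hz', Prod.mk_sub_mk, sub_neg_eq_add, Prod.norm_mk]
    exact max_le h1 h2
  refine ⟨(a', b'), ?_, ?_⟩
  · calc ‖(a', b')‖ ≤ c * (‖a‖ + ‖b‖) := max_le ha' hb'
      _ ≤ c * (2 * ‖(a, b)‖) := by gcongr
      _ = 2 * c * ‖(a, b)‖ := by ring
  · rw [mul_comm 2 c, mul_assoc]
    exact (he _ rfl).trans (mul_le_mul_of_nonneg_left hn' hc.le)

/-- The second component of the cone estimate, one for each `μ`, is the hypothesis `hK` of
`StrictExact.descend`: degree `p + 1` of all extensions to `L` controls degree `p` of `A`. -/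
theorem strictExactAt_descend (h : CodimOne i r φ x δ) {ρ : L →ₗ[ℂ] E →L[ℂ] E}
    (hρ : IsRightAction ρ) {g : Module.Dual ℂ A} (hg : g ∈ characters A) (hδ : g ∘ₗ δ = 0) (p : ℕ)
    (h₁ : StrictExactAt (ρ ∘ₗ (i : A →ₗ[ℂ] L)) g (p + 1))
    (hL : ∀ μ : ℂ, StrictExactAt ρ (g ∘ₗ r + μ • φ) (p + 1)) :
    StrictExactAt (ρ ∘ₗ (i : A →ₗ[ℂ] L)) g p := by
  have hcx := isComplex_of_mem_characters (hρ.comp i) hg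
  have key : StrictExact (bdL (ρ ∘ₗ (i : A →ₗ[ℂ] L)) g p : Chain A E (p + 1) →ₗ[ℂ] Chain A E p)
      (diffL (ρ ∘ₗ (i : A →ₗ[ℂ] L)) g p : Chain A E p →ₗ[ℂ] Chain A E (p - 1)) := by
    have hκ : ∃ κ : ℝ, ∀ y : Chain A E p, ‖diffL (ρ ∘ₗ (i : A →ₗ[ℂ] L)) g p
        (lieOpL (ρ x) δ p y)‖ ≤ κ * ‖diffL (ρ ∘ₗ (i : A →ₗ[ℂ] L)) g p y‖ := by
      cases p with
      | zero =>
        refine ⟨0, fun y => ?_⟩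
        change ‖(0 : Chain A E 0)‖ ≤ _
        simp
      | succ p =>
        refine ⟨‖lieOpL (ρ x) δ p (E := E)‖, fun y => ?_⟩
        change ‖bd (ρ ∘ₗ (i : A →ₗ[ℂ] L)) g p (lieOp (ρ x) δ (p + 1) y)‖ ≤ _
        rw [← h.lieOp_bd hρ hδ]
        exact (lieOpL (ρ x) δ p).le_opNorm _
    obtain ⟨κ, hκ⟩ := hκ
    refine StrictExact.descend (fun b => hcx p b) (fun b => ?_) h₁ (lieOpL (ρ x) δ (p + 1))
      (lieOpL (ρ x) δ p) (h.lieOp_bd hρ hδ p) hκ fun μ => ?_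
    · rw [diffL_apply]
      exact hcx.differential_bd p b
    · have hs := hL μ
      rw [h.strictExactAt_succ_iff, (h.extension_apply g μ).1, (h.extension_apply g μ).2] at hs
      obtain ⟨c, hc, H⟩ := hs
      refine ⟨c, hc, fun a b => ?_⟩
      obtain ⟨⟨a', b'⟩, -, h2⟩ := H (a, b)
      refine ⟨b', ?_⟩
      have h3 : ‖b + bd (ρ ∘ₗ (i : A →ₗ[ℂ] L)) g p b'‖ ≤
          c * ‖coneDiff (ρ ∘ₗ (i : A →ₗ[ℂ] L)) g (ρ x) δ μ p (a, b)‖ := by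
        rw [← sub_neg_eq_add]
        exact (norm_snd_le _).trans h2
      rw [coneDiff_apply, Prod.norm_mk, norm_neg] at h3
      refine h3.trans (mul_le_mul_of_nonneg_left ?_ hc.le)
      rw [diffL_apply]
      exact max_le_add_of_nonneg (norm_nonneg _) (norm_nonneg _)
  rw [coe_diffL] at key
  exact key

/-- The projection property for an ideal of codimension one. -/
theorem image_strictSpectrum (h : CodimOne i r φ x δ) {ρ : L →ₗ[ℂ] E →L[ℂ] E}
    (hρ : IsRightAction ρ) (k : ℕ) :
    (fun f : Module.Dual ℂ L => f ∘ₗ (i : A →ₗ[ℂ] L)) '' (⋃ p ∈ Set.Ici k, strictSpectrum ρ p) =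
      ⋃ p ∈ Set.Ici (k - 1), strictSpectrum (ρ ∘ₗ (i : A →ₗ[ℂ] L)) p := by
  ext g
  simp only [Set.mem_image, Set.mem_iUnion, Set.mem_Ici, exists_prop]
  constructor
  · rintro ⟨f, ⟨p, hp, hf, hn⟩, rfl⟩
    by_contra hcon
    push Not at hcon
    have hA : ∀ q, k - 1 ≤ q →
        StrictExactAt (ρ ∘ₗ (i : A →ₗ[ℂ] L)) (f ∘ₗ (i : A →ₗ[ℂ] L)) q := by
      intro q hq
      by_contra hnq
      exact hcon q hq ⟨comp_mem_characters hf i, hnq⟩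
    refine hn ?_
    cases p with
    | zero => exact strictExactAt_zero_of_comp i r ρ f (hA 0 (by omega))
    | succ p => exact h.strictExactAt_succ hρ hf p (hA _ (by omega)) (hA _ (by omega))
  · rintro ⟨q, hq, hg⟩
    have hδ : g ∘ₗ δ = 0 := comp_eq_zero_of_mem_strictSpectrum _ (ρ x) δ (hρ.comp i)
      h.derivation (h.implemented hρ) hg
    by_contra hcon
    push Not at hcon
    have hL : ∀ p, k ≤ p → ∀ μ : ℂ, StrictExactAt ρ (g ∘ₗ r + μ • φ) p := by
      intro p hp μ
      by_contra hnp
      exact hcon _ ⟨p, hp, h.extension_mem_characters hg.1 hδ μ, hnp⟩ (h.extension_apply g μ).1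
    -- Descending induction on `q`, started above `dim A` where there are no chains; `m` bounds the
    -- distance to that range.
    have hA : ∀ m q, k - 1 ≤ q → Module.finrank ℂ A < q + m →
        StrictExactAt (ρ ∘ₗ (i : A →ₗ[ℂ] L)) g q := by
      intro m
      induction m with
      | zero => exact fun q _ hlt => strictExactAt_of_lt _ _ hlt
      | succ m ih =>
        intro q hq hlt
        exact h.strictExactAt_descend hρ hg.1 hδ q (ih (q + 1) (by omega) (by omega))
          (hL (q + 1) (by omega))
    exact hg.2 (hA (Module.finrank ℂ A + 1) q hq (by omega))

end CodimOne

/-- The spectra are invariant under isomorphisms. -/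
theorem image_strictSpectrum_of_bijective {i : A →ₗ⁅ℂ⁆ L} (hi : Function.Bijective i)
    {ρ : L →ₗ[ℂ] E →L[ℂ] E} (k : ℕ) :
    (fun f : Module.Dual ℂ L => f ∘ₗ (i : A →ₗ[ℂ] L)) '' (⋃ p ∈ Set.Ici k, strictSpectrum ρ p) =
      ⋃ p ∈ Set.Ici k, strictSpectrum (ρ ∘ₗ (i : A →ₗ[ℂ] L)) p := by
  let r : L →ₗ[ℂ] A := (LinearEquiv.ofBijective (i : A →ₗ[ℂ] L) hi).symm
  have hri : r ∘ₗ (i : A →ₗ[ℂ] L) = LinearMap.id :=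
    LinearMap.ext fun a => (LinearEquiv.ofBijective (i : A →ₗ[ℂ] L) hi).symm_apply_apply a
  have hir : (i : A →ₗ[ℂ] L) ∘ₗ r = LinearMap.id :=
    LinearMap.ext fun a => (LinearEquiv.ofBijective (i : A →ₗ[ℂ] L) hi).apply_symm_apply a
  have hir' : ∀ y, i (r y) = y := fun y => LinearMap.congr_fun hir y
  have hbd : ∀ (f : Module.Dual ℂ L) p (b : Chain L E (p + 1)), cmap E r p (bd ρ f p b) =
      bd (ρ ∘ₗ (i : A →ₗ[ℂ] L)) (f ∘ₗ (i : A →ₗ[ℂ] L)) p (cmap E r (p + 1) b) := by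
    intro f p b
    have h1 : b = cmap E (i : A →ₗ[ℂ] L) (p + 1) (cmap E r (p + 1) b) := by
      rw [cmap_cmap, hir, cmap_id]
    conv_lhs => rw [h1, ← cmap_bd, cmap_cmap, hri, cmap_id]
  have hex : ∀ (f : Module.Dual ℂ L) p,
      StrictExactAt (ρ ∘ₗ (i : A →ₗ[ℂ] L)) (f ∘ₗ (i : A →ₗ[ℂ] L)) p ↔ StrictExactAt ρ f p := by
    intro f p
    constructor
    · intro hs
      refine StrictExact.transport hs (cmapL E (i : A →ₗ[ℂ] L) (p + 1))
        (cmapL E (i : A →ₗ[ℂ] L) p) (cmapL E r p)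
        (fun y => by simp [cmap_cmap, hir, cmap_id]) (fun y => cmap_bd ρ f i p y)
        (c := ‖cmapL E r (p - 1)‖) fun y => ?_
      cases p with
      | zero =>
        change ‖(0 : Chain A E 0)‖ ≤ _
        rw [norm_zero]
        positivity
      | succ p =>
        refine le_of_eq_of_le (congrArg norm (hbd f p y).symm) ?_
        exact (cmapL E r p).le_opNorm _
    · intro hs
      refine StrictExact.transport hs (cmapL E r (p + 1)) (cmapL E r p)
        (cmapL E (i : A →ₗ[ℂ] L) p)
        (fun y => by simp [cmap_cmap, hri, cmap_id]) (fun y => hbd f p y)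
        (c := ‖cmapL E (i : A →ₗ[ℂ] L) (p - 1)‖) fun y => ?_
      cases p with
      | zero =>
        change ‖(0 : Chain L E 0)‖ ≤ _
        rw [norm_zero]
        positivity
      | succ p =>
        refine le_of_eq_of_le (congrArg norm (cmap_bd ρ f i p y).symm) ?_
        exact (cmapL E (i : A →ₗ[ℂ] L) p).le_opNorm _
  ext g
  simp only [Set.mem_image, Set.mem_iUnion, Set.mem_Ici, exists_prop]
  constructor
  · rintro ⟨f, ⟨p, hp, hf, hn⟩, rfl⟩
    exact ⟨p, hp, comp_mem_characters hf i, fun hs => hn ((hex f p).1 hs)⟩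
  · rintro ⟨p, hp, hg, hn⟩
    have hgr : (g ∘ₗ r) ∘ₗ (i : A →ₗ[ℂ] L) = g := by
      rw [LinearMap.comp_assoc, hri, LinearMap.comp_id]
    refine ⟨g ∘ₗ r, ⟨p, hp, fun y z => ?_, fun hs => hn ?_⟩, hgr⟩
    · have h1 := LinearMap.congr_fun hgr ⁅r y, r z⁆
      rw [hg, LinearMap.comp_apply, LieHom.coe_toLinearMap, LieHom.map_lie, hir', hir'] at h1
      exact h1
    · have := (hex (g ∘ₗ r) p).2 hs
      rwa [hgr] at this

/-- In a solvable Lie algebra a proper ideal does not span the algebra modulo brackets. -/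
theorem derived_sup_ne_top [LieAlgebra.IsSolvable L] {K : LieIdeal ℂ L} (hK : K ≠ ⊤) :
    ⁅(⊤ : LieIdeal ℂ L), (⊤ : LieIdeal ℂ L)⁆ ⊔ K ≠ ⊤ := by
  intro h
  -- If `D + K = L`, then `[L, L] ⊆ [D, D] + K`, so `[D, D] + K = L` as well. Solvability finally
  -- gives `D = 0`, that is `K = L`.
  have key : ∀ n, LieAlgebra.derivedSeries ℂ L n ⊔ K = ⊤ := by
    intro n
    induction n with
    | zero => simp [LieAlgebra.derivedSeries_def]
    | succ n ih =>
      rw [LieAlgebra.derivedSeries_def, LieAlgebra.derivedSeriesOfIdeal_succ,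
        ← LieAlgebra.derivedSeries_def]
      generalize LieAlgebra.derivedSeries ℂ L n = D at ih
      refine eq_top_iff.2 ?_
      have h1 : ⁅(⊤ : LieIdeal ℂ L), (⊤ : LieIdeal ℂ L)⁆ ≤ ⁅D, D⁆ ⊔ K := by
        conv_lhs => rw [← ih]
        rw [LieSubmodule.sup_lie, LieSubmodule.lie_sup]
        refine sup_le (sup_le le_sup_left ?_) ?_
        · exact (LieSubmodule.lie_le_right _ _).trans le_sup_right
        · exact (LieSubmodule.lie_le_left _ _).trans le_sup_right
      rw [← h]
      exact sup_le h1 le_sup_right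
  obtain ⟨n, hn⟩ := LieAlgebra.IsSolvable.solvable ℂ L
  have := key n
  rw [hn, bot_sup_eq] at this
  exact hK this

/-- A proper ideal of a solvable Lie algebra is contained in the kernel of a nonzero character. -/
theorem exists_character_of_ne_top [LieAlgebra.IsSolvable L] {K : LieIdeal ℂ L} (hK : K ≠ ⊤) :
    ∃ φ ∈ characters L, φ ≠ 0 ∧ ∀ y ∈ K, φ y = 0 := by
  have h := derived_sup_ne_top hK
  let M : Submodule ℂ L := (⁅(⊤ : LieIdeal ℂ L), (⊤ : LieIdeal ℂ L)⁆ ⊔ K : LieIdeal ℂ L)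
  have hM : M < ⊤ := lt_top_iff_ne_top.2 fun hM => h (by
    rw [← LieSubmodule.toSubmodule_eq_top]
    exact hM)
  obtain ⟨φ, hφ, hle⟩ := Submodule.exists_le_ker_of_lt_top M hM
  refine ⟨φ, fun y z => ?_, hφ, fun y hy => ?_⟩
  · refine hle ?_
    have h1 : ⁅y, z⁆ ∈ ⁅(⊤ : LieIdeal ℂ L), (⊤ : LieIdeal ℂ L)⁆ :=
      LieSubmodule.lie_mem_lie (LieSubmodule.mem_top _) (LieSubmodule.mem_top _)
    exact (le_sup_left : ⁅(⊤ : LieIdeal ℂ L), (⊤ : LieIdeal ℂ L)⁆ ≤ _ ⊔ K) h1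
  · exact hle ((le_sup_right : K ≤ ⁅(⊤ : LieIdeal ℂ L), (⊤ : LieIdeal ℂ L)⁆ ⊔ K) hy)

/-- The kernel of a character as an ideal. -/
def characterKer (φ : Module.Dual ℂ L) (hφ : φ ∈ characters L) : LieIdeal ℂ L where
  toSubmodule := LinearMap.ker φ
  lie_mem {y z} _ := hφ y z

theorem mem_characterKer {φ : Module.Dual ℂ L} {hφ : φ ∈ characters L} {y : L} :
    y ∈ characterKer φ hφ ↔ φ y = 0 := Iff.rfl

theorem exists_codimOne {φ : Module.Dual ℂ L} (hφ : φ ∈ characters L) (h0 : φ ≠ 0) :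
    ∃ φ' r x δ, CodimOne (characterKer φ hφ).incl r φ' x δ := by
  obtain ⟨x, hx⟩ : ∃ x, φ x = 1 := by
    obtain ⟨y, hy⟩ := DFunLike.ne_iff.1 h0
    refine ⟨(φ y)⁻¹ • y, ?_⟩
    rw [map_smul, smul_eq_mul, inv_mul_cancel₀ hy]
  let r : L →ₗ[ℂ] characterKer φ hφ :=
    LinearMap.codRestrict (LinearMap.ker φ) (LinearMap.id - φ.smulRight x) fun y => by
      simp [hx]
  let δ : characterKer φ hφ →ₗ[ℂ] characterKer φ hφ :=
    (adL x).restrict fun y _ => hφ x y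
  refine ⟨φ, r, x, δ, ?_, ?_, fun a => a.2, hx, fun y => rfl, fun a => rfl⟩
  · intro a
    apply Subtype.ext
    change a.1 - φ a.1 • x = a.1
    rw [mem_characterKer.1 a.2, zero_smul, sub_zero]
  · apply Subtype.ext
    change x - φ x • x = 0
    rw [hx, one_smul, sub_self]

theorem finrank_characterKer {φ : Module.Dual ℂ L} (hφ : φ ∈ characters L) (h0 : φ ≠ 0) :
    Module.finrank ℂ (characterKer φ hφ) + 1 = Module.finrank ℂ L :=
  Module.Dual.finrank_ker_add_one_of_ne_zero h0

/-- The projection property for the embedding of an ideal. -/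
theorem image_strictSpectrum_of_ideal (d : ℕ) : ∀ {L : Type u} [LieRing L] [LieAlgebra ℂ L]
    [FiniteDimensional ℂ L] [LieAlgebra.IsSolvable L] (i : A →ₗ⁅ℂ⁆ L) (_ : Function.Injective i)
    (_ : ∀ (x : L) (a : A), ∃ b : A, i b = ⁅x, i a⁆) (ρ : L →ₗ[ℂ] E →L[ℂ] E) (_ : IsRightAction ρ) (k : ℕ)
    (_ : Module.finrank ℂ L = Module.finrank ℂ A + d),
    (fun f : Module.Dual ℂ L => f ∘ₗ (i : A →ₗ[ℂ] L)) '' (⋃ p ∈ Set.Ici k, strictSpectrum ρ p) =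
      ⋃ p ∈ Set.Ici (k - d), strictSpectrum (ρ ∘ₗ (i : A →ₗ[ℂ] L)) p := by
  induction d with
  | zero =>
    intro L _ _ _ _ i hi _ ρ _ k hd
    refine image_strictSpectrum_of_bijective ⟨hi, ?_⟩ k
    exact (LinearMap.injective_iff_surjective_of_finrank_eq_finrank
      (f := (i : A →ₗ[ℂ] L)) (by omega)).1 hi
  | succ d ih =>
    intro L _ _ _ _ i hi hideal ρ hρ k hd
    let K : LieIdeal ℂ L :=
      { LinearMap.range (i : A →ₗ[ℂ] L) with
        lie_mem := by
          rintro x _ ⟨a, rfl⟩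
          exact hideal x a }
    have hK : K ≠ ⊤ := by
      intro hK
      have h1 : LinearMap.range (i : A →ₗ[ℂ] L) = ⊤ := by
        rw [← LieSubmodule.toSubmodule_eq_top] at hK
        exact hK
      have h2 := LinearMap.finrank_range_of_inj (f := (i : A →ₗ[ℂ] L)) hi
      rw [h1, finrank_top] at h2
      omega
    -- The kernel of `φ` is a solvable ideal of codimension one containing the image of `A` as an
    -- ideal of codimension `d`; the induction hypothesis handles `A` inside it. Working with an
    -- embedding `i` keeps `A` fixed while the ambient algebra shrinks.
    obtain ⟨φ, hφ, h0, hKφ⟩ := exists_character_of_ne_top hK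
    obtain ⟨φ', r, x, δ, hC⟩ := exists_codimOne hφ h0
    have hmem : ∀ a, i a ∈ characterKer φ hφ := fun a => hKφ _ ⟨a, rfl⟩
    let i' : A →ₗ⁅ℂ⁆ characterKer φ hφ :=
      { LinearMap.codRestrict (LinearMap.ker φ) (i : A →ₗ[ℂ] L) hmem with
        map_lie' := fun {a b} => Subtype.ext (i.map_lie a b) }
    have hfac : ((characterKer φ hφ).incl : characterKer φ hφ →ₗ[ℂ] L) ∘ₗ
        (i' : A →ₗ[ℂ] characterKer φ hφ) = (i : A →ₗ[ℂ] L) := rfl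
    have hsolv : LieAlgebra.IsSolvable (characterKer φ hφ) :=
      Function.Injective.lieAlgebra_isSolvable hC.injective
    have h1 := ih i' (fun a b hab => hi (congrArg Subtype.val hab))
      (fun y a => by
        obtain ⟨b, hb⟩ := hideal y.1 a
        exact ⟨b, Subtype.ext hb⟩)
      (ρ ∘ₗ ((characterKer φ hφ).incl : characterKer φ hφ →ₗ[ℂ] L)) (hρ.comp _) (k - 1)
      (by have := finrank_characterKer hφ h0; omega)
    rw [← hC.image_strictSpectrum hρ k, Set.image_image, LinearMap.comp_assoc, hfac,
      Nat.sub_sub, add_comm 1 d] at h1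
    exact h1

end Projection

end LieSpectra

end

theorem theorem4p10 {L : Type*} [LieRing L] [LieAlgebra ℂ L] [FiniteDimensional ℂ L]
    [LieAlgebra.IsSolvable L]
    {E : Type*} [NormedAddCommGroup E] [NormedSpace ℂ E] [CompleteSpace E]
    (ρ : L →ₗ[ℂ] E →L[ℂ] E) (hρ : LieSpectra.IsRightAction ρ)
    (k : ℕ) (hk : k ≤ Module.finrank ℂ L) :
    @IsCompact _ (LieSpectra.dualTopology L) (LieSpectra.sigmaPi ρ k) ∧
    ∀ I : LieIdeal ℂ L,
      LieSpectra.restrict I '' LieSpectra.sigmaPi ρ k =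
        LieSpectra.sigmaPi (ρ ∘ₗ (I.incl : I →ₗ[ℂ] L))
          (Module.finrank ℂ I - (Module.finrank ℂ L - k)) := by
  refine ⟨?_, fun I => ?_⟩
  · rw [LieSpectra.dualTopology_eq]
    exact LieSpectra.isCompact_sigmaPi ρ hρ k
  · have hle : Module.finrank ℂ I ≤ Module.finrank ℂ L :=
      Submodule.finrank_le I.toSubmodule
    rw [LieSpectra.sigmaPi_eq ρ hρ, LieSpectra.sigmaPi_eq _ (hρ.comp I.incl)]
    have h := LieSpectra.image_strictSpectrum_of_ideal (Module.finrank ℂ L - Module.finrank ℂ I)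
      I.incl Subtype.val_injective
      (fun x a => ⟨⟨⁅x, a.1⁆, I.lie_mem a.2⟩, rfl⟩) ρ hρ k (by omega)
    -- Truncated subtraction plays the role of the maximum with `0`; the two expressions agree
    -- because `k` and `dim I` are at most `dim L`.
    rw [show Module.finrank ℂ I - (Module.finrank ℂ L - k) =
      k - (Module.finrank ℂ L - Module.finrank ℂ I) by omega]
    exact h
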